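/- A reachability MDP consists of a finite set $S$ of nodes (states), a finite set $A_s$ of available actions for each $s\in S$ (a sink is a node with $A_s=\emptyset$), a probability distribution $p(\cdot\mid s,a)$ on $S$ for each $s \in S$ and $a\in A_s$, and a designated target sink $s^*$; there are no rewards. A policy $\pi$ selects an action $\pi(s)\in A_s$ at each non-sink node $s$. Its value $\mathrm{Val}^\pi(s)$ is the probability that the Markov chain which starts at $s$, follows $\pi$ and stays at sinks reaches $s^*$. The appeal of $a\in A_s$ under $\pi$ is $\mathrm{Appeal}^\pi(s,a)=\sum_{s'\in S}p(s'\mid s,a)\,\mathrm{Val}^\pi(s')$, and $s$ is switchable if $\mathrm{Appeal}^\pi(s,a)>\mathrm{Val}^\pi(s)$ for some $a\in A_s$. One iteration of Greedy (Howard's) policy iteration simultaneously switches every switchable node $s$ to an action in $\arg\max_{a\in A_s}\mathrm{Appeal}^\pi(s,a)$ (ties broken arbitrarily) and leaves all other nodes unchanged. A policy is optimal if it maximizes the value of every node among all policies. Theorem. Greedy policy iteration under the reachability criterion can take $2^{\Omega(N)}$ iterations to arrive at an optimal policy on an MDP with $N$ nodes. Precisely: there are a constant $c>0$ and an $N_0$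 such that for every $N\ge N_0$ there exist a reachability MDP with exactly $N$ nodes and at most $N$ actions at each node, and a starting policy $\pi_0$, such that every run of Greedy policy iteration started at $\pi_0$ (whatever the tie-breaking) arrives at an optimal policy, and does so for the first time after at least $2^{cN}$ iterations. -/

import Mathlib

/-- A finite Markov decision process without rewards, with state set `S`, all actions taken from
`A`, and a designated target sink.  `act s` is the finite set of actions available at `s`;
a *sink* is a state with no actions.  `p s a s'` is the probability of ending up at `s'` when
action `a ∈ act s` is taken at `s` (its value for `a ∉ act s` is irrelevant). -/
structure ReachabilityMDP (S A : Type) [Fintype S] where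
  act : S → Finset A
  p : S → A → S → ℝ
  p_nonneg : ∀ s, ∀ a ∈ act s, ∀ s', 0 ≤ p s a s'
  p_sum : ∀ s, ∀ a ∈ act s, ∑ s', p s a s' = 1
  target : S
  target_sink : act target = ∅

namespace ReachabilityMDP

variable {S A : Type} [Fintype S] [DecidableEq S] (M : ReachabilityMDP S A)

/-- A (positional) policy selects an available action at every state that is not a sink.
(The value of `π` at a sink plays no role anywhere.) -/
def IsPolicy (π : S → A) : Prop :=
  ∀ s, (M.act s).Nonempty → π s ∈ M.act s

/-- The transition matrix of the Markov chain induced by a policy: at a state that is not a sink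
the chain follows the selected action; once in a sink it stays there. -/
noncomputable def chain (π : S → A) : Matrix S S ℝ := fun s s' =>
  if (M.act s).Nonempty then M.p s (π s) s' else if s' = s then 1 else 0

/-- The value of `s` under `π`: the probability that the induced chain started at `s` reaches the
target.  As the chain never leaves the target, `(chain π ^ k) s target` is the probability that the
target is reached within `k` steps; it is nondecreasing in `k`, and its supremum is the probability
that the target is ever reached. -/
noncomputable def val (π : S → A) (s : S) : ℝ :=
  ⨆ k : ℕ, (M.chain π ^ k) s M.target

/-- The appeal of the action `a` at `s` under the current policy `π`. -/
noncomputable def appeal (π : S → A) (s : S) (a : A) : ℝ :=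
  ∑ s', M.p s a s' * M.val π s'

/-- A state is switchable if some available action has appeal larger than the state's value. -/
def Switchable (π : S → A) (s : S) : Prop :=
  ∃ a ∈ M.act s, M.val π s < M.appeal π s a

/-- One iteration of Greedy (Howard's) policy iteration: every switchable state switches to an
available action of greatest appeal (ties broken in any way); every other state keeps its
action. -/
def GreedyStep (π π' : S → A) : Prop :=
  ∀ s, (M.Switchable π s →
      π' s ∈ M.act s ∧ ∀ a ∈ M.act s, M.appeal π s a ≤ M.appeal π s (π' s)) ∧
    (¬ M.Switchable π s → π' s = π s)

/-- An optimal policy maximizes the value of every state among all policies. -/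
def IsOptimal (π : S → A) : Prop :=
  M.IsPolicy π ∧ ∀ π', M.IsPolicy π' → ∀ s, M.val π' s ≤ M.val π s

end ReachabilityMDP

/-!
If traversing an edge of cost `c` succeeds with probability `2⁻¹ ^ c` and otherwise ends in a losing
sink, then the value of a node is `2⁻¹` to the length of its path to the target, so Greedy performs
a simultaneous shortest-path improvement. An edge that is traversed only with tiny probability per
step does not change these lengths, but its appeal barely exceeds the value of its node, so Greedy
takes it only when no ordinary edge helps.

The counter graph turns this into a binary counter. Lengths are lexicographic pairs of a loss and a
delay, and the loss from the hub is minus the stored number `C`. Setting the bit `k` requires a slow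
edge, from which the node `bit k` is distracted by an ordinary one as long as it can: in every
iteration the clock makes one more lane slightly better, and `bit k` follows it up to the lane
`2 * k`. Hence the lowest unset bit is the first to run out of distractions and takes its slow edge.
This lowers the loss from the hub to `-(C + 1)`, whereupon the lower bits and the clock all prefer
the hub: they are reset, and the counter has been incremented. The path from the lanes keeps
getting shorter until `C` has run through all numbers from `2 ^ n` to `2 ^ (n + 1) - 1`.
-/

namespace ReachabilityMDP

open Filter Matrix Topology

variable {S A : Type} [Fintype S] [DecidableEq S] (M : ReachabilityMDP S A) {π π' : S → A}

theorem chain_mem_rowStochastic (hπ : M.IsPolicy π) : M.chain π ∈ rowStochastic ℝ S := by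
  refine mem_rowStochastic_iff_sum.2 ⟨fun s s' ↦ ?_, fun s ↦ ?_⟩ <;> unfold chain <;> split_ifs
  · exact M.p_nonneg s _ (hπ s ‹_›) s'
  · exact zero_le_one
  · exact le_rfl
  · exact M.p_sum s _ (hπ s ‹_›)
  · simp

theorem chain_pow_nonneg (hπ : M.IsPolicy π) (k : ℕ) (s s' : S) : 0 ≤ (M.chain π ^ k) s s' :=
  nonneg_of_mem_rowStochastic (pow_mem (M.chain_mem_rowStochastic hπ) k)

theorem bddAbove_chain_pow (hπ : M.IsPolicy π) (s : S) :
    BddAbove (Set.range fun k : ℕ ↦ (M.chain π ^ k) s M.target) := by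
  refine ⟨1, ?_⟩
  rintro _ ⟨k, rfl⟩
  exact le_one_of_mem_rowStochastic (pow_mem (M.chain_mem_rowStochastic hπ) k)

theorem val_nonneg (hπ : M.IsPolicy π) (s : S) : 0 ≤ M.val π s :=
  Real.iSup_nonneg fun k ↦ M.chain_pow_nonneg hπ k s M.target

theorem val_le_of_chain_mulVec_le (hπ : M.IsPolicy π) {v : S → ℝ} (hv : 0 ≤ v)
    (htarget : 1 ≤ v M.target) (hsuper : M.chain π *ᵥ v ≤ v) (s : S) : M.val π s ≤ v s := by
  refine ciSup_le fun k ↦ ?_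
  induction k generalizing s with
  | zero =>
    rw [pow_zero, one_apply]
    split_ifs with hs
    · exact hs ▸ htarget
    · exact hv s
  | succ k ih =>
    rw [pow_succ', mul_apply]
    exact (Finset.sum_le_sum fun x _ ↦ mul_le_mul_of_nonneg_left (ih x)
      (nonneg_of_mem_rowStochastic (M.chain_mem_rowStochastic hπ))).trans (hsuper s)

theorem chain_of_sink {s : S} (hs : M.act s = ∅) : M.chain π s = Pi.single s 1 := by
  ext s'
  simp [chain, hs, Pi.single_apply]

theorem chain_pow_of_sink {s : S} (hs : M.act s = ∅) (k : ℕ) :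
    (M.chain π ^ k) s = Pi.single s 1 := by
  induction k with
  | zero =>
    ext s'
    simp [one_apply, Pi.single_apply, eq_comm]
  | succ k ih =>
    rw [pow_succ', mul_apply_eq_vecMul, M.chain_of_sink hs, single_one_vecMul]
    exact ih

theorem val_target : M.val π M.target = 1 := by
  simp [val, M.chain_pow_of_sink M.target_sink]

theorem val_of_sink {s : S} (hs : M.act s = ∅) (hne : s ≠ M.target) : M.val π s = 0 := by
  simp [val, M.chain_pow_of_sink hs, hne.symm]

theorem tendsto_chain_pow_val (hπ : M.IsPolicy π) (s : S) :
    Tendsto (fun k : ℕ ↦ (M.chain π ^ k) s M.target) atTop (𝓝 (M.val π s)) := by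
  refine tendsto_atTop_ciSup (monotone_nat_of_le_succ fun k ↦ ?_) (M.bddAbove_chain_pow hπ s)
  have htarget : M.chain π M.target M.target = 1 := by simp [M.chain_of_sink M.target_sink]
  calc (M.chain π ^ k) s M.target
    _ = (M.chain π ^ k) s M.target * M.chain π M.target M.target := by rw [htarget, mul_one]
    _ ≤ ∑ x, (M.chain π ^ k) s x * M.chain π x M.target :=
      Finset.single_le_sum (f := fun x ↦ (M.chain π ^ k) s x * M.chain π x M.target)
        (fun x _ ↦ mul_nonneg (M.chain_pow_nonneg hπ k s x)
          (nonneg_of_mem_rowStochastic (M.chain_mem_rowStochastic hπ))) (Finset.mem_univ _)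
    _ = (M.chain π ^ (k + 1)) s M.target := by rw [pow_succ, mul_apply]

theorem chain_mulVec_val (hπ : M.IsPolicy π) : M.chain π *ᵥ M.val π = M.val π := by
  ext s
  have hsum : Tendsto (fun k : ℕ ↦ ∑ s', M.chain π s s' * (M.chain π ^ k) s' M.target) atTop
      (𝓝 (∑ s', M.chain π s s' * M.val π s')) :=
    tendsto_finsetSum _ fun x _ ↦ (M.tendsto_chain_pow_val hπ x).const_mul _
  refine tendsto_nhds_unique (hsum.congr fun k ↦ ?_)
    ((M.tendsto_chain_pow_val hπ s).comp (tendsto_add_atTop_nat 1))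
  simp only [Function.comp, pow_succ', mul_apply]

theorem chain_mulVec_val_eq_appeal {s : S} (hs : (M.act s).Nonempty) :
    (M.chain π *ᵥ M.val π') s = M.appeal π' s (π s) := by
  simp [mulVec, dotProduct, appeal, chain, hs]

theorem appeal_self (hπ : M.IsPolicy π) {s : S} (hs : (M.act s).Nonempty) :
    M.appeal π s (π s) = M.val π s := by
  rw [← M.chain_mulVec_val_eq_appeal hs, M.chain_mulVec_val hπ]

theorem isOptimal_of_forall_not_switchable (hπ : M.IsPolicy π) (h : ∀ s, ¬ M.Switchable π s) :
    M.IsOptimal π := by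
  refine ⟨hπ, fun π' hπ' ↦ M.val_le_of_chain_mulVec_le hπ' (M.val_nonneg hπ) M.val_target.ge
    fun s ↦ ?_⟩
  rcases (M.act s).eq_empty_or_nonempty with hs | hs
  · simp [mulVec, M.chain_of_sink hs]
  · rw [M.chain_mulVec_val_eq_appeal hs]
    exact not_lt.1 fun hlt ↦ h s ⟨_, hπ' s hs, hlt⟩

variable {M}

theorem GreedyStep.eq_of_forall_appeal_lt (hstep : M.GreedyStep π π') {s : S} {a : A}
    (ha : a ∈ M.act s) (hlt : M.val π s < M.appeal π s a)
    (hbest : ∀ b ∈ M.act s, b ≠ a → M.appeal π s b < M.appeal π s a) : π' s = a := by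
  obtain ⟨hmem, hmax⟩ := (hstep s).1 ⟨a, ha, hlt⟩
  by_contra hne
  exact (hbest _ hmem hne).not_ge (hmax a ha)

end ReachabilityMDP

/-- A finite directed graph in which traversing the edge from `s` to `s'` costs `cost s s'`.  Its
MDP has the edges as actions: the edge is traversed with probability `rate s s'` per step, and a
traversal survives with probability `2⁻¹ ^ cost s s'` and otherwise ends in `dead`. -/
structure LossyGraph (S : Type) where
  edges : S → Finset S
  cost : S → S → ℤ
  rate : S → S → ℝ
  target : S
  dead : S
  cost_pos : ∀ s, ∀ s' ∈ edges s, 0 < cost s s'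
  rate_pos : ∀ s, ∀ s' ∈ edges s, 0 < rate s s'
  rate_le_one : ∀ s, ∀ s' ∈ edges s, rate s s' ≤ 1
  edges_target : edges target = ∅
  edges_dead : edges dead = ∅
  target_ne_dead : target ≠ dead
  dest_eq_target_or : ∀ s, ∀ s' ∈ edges s, s' = target ∨ (edges s').Nonempty

namespace LossyGraph

variable {S : Type} (G : LossyGraph S)

/-- `D s` is the length of the path that `π` takes from `s` to the target; `D` is unconstrained
at `dead`. -/
structure IsDist (π : S → S) (D : S → ℤ) : Prop where
  mem_edges : ∀ s, (G.edges s).Nonempty → π s ∈ G.edges s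
  dist_target : D G.target = 0
  dist_eq : ∀ s, (G.edges s).Nonempty → D s = G.cost s (π s) + D (π s)

variable {G} {π π' : S → S} {D : S → ℤ}

theorem IsDist.path_induction [Finite S] (h : G.IsDist π D) {P : S → Prop} (target : P G.target)
    (step : ∀ s, (G.edges s).Nonempty → P (π s) → P s) {s : S}
    (hs : s = G.target ∨ (G.edges s).Nonempty) : P s := by
  have hwf : WellFounded (InvImage (· < ·) D) := Finite.wellFounded_of_trans_of_irrefl _
  induction s using hwf.induction with
  | _ s ih =>
    rcases hs with rfl | hs
    · exact target
    · have hmem := h.mem_edges s hs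
      have hlt : D (π s) < D s := by
        rw [h.dist_eq s hs]
        exact lt_add_of_pos_left _ (G.cost_pos s _ hmem)
      exact step s hs (ih _ hlt (G.dest_eq_target_or s _ hmem))

theorem IsDist.dist_nonneg [Finite S] (h : G.IsDist π D) {s : S}
    (hs : s = G.target ∨ (G.edges s).Nonempty) : 0 ≤ D s := by
  refine h.path_induction (P := fun s ↦ 0 ≤ D s) h.dist_target.ge (fun s hs hnonneg ↦ ?_) hs
  rw [h.dist_eq s hs]
  exact add_nonneg (G.cost_pos s _ (h.mem_edges s hs)).le hnonneg

variable [Fintype S] [DecidableEq S]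

/-- The MDP of a lossy graph; the actions at a state are the endpoints of its edges. -/
noncomputable def toMDP (G : LossyGraph S) : ReachabilityMDP S S where
  act := G.edges
  p s a := Pi.single s (1 - G.rate s a) + Pi.single a (G.rate s a * 2⁻¹ ^ G.cost s a) +
    Pi.single G.dead (G.rate s a * (1 - 2⁻¹ ^ G.cost s a))
  p_nonneg s a ha s' := by
    have hsurvive : (2⁻¹ : ℝ) ^ G.cost s a ≤ 1 :=
      zpow_le_one₀ (by norm_num) (by norm_num) (G.cost_pos s a ha).le
    have hsingle {x : ℝ} (t : S) (hx : 0 ≤ x) : 0 ≤ (Pi.single t x : S → ℝ) s' :=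
      (Pi.single_nonneg.2 hx : 0 ≤ (Pi.single t x : S → ℝ)) s'
    have hrate := (G.rate_pos s a ha).le
    exact add_nonneg (add_nonneg (hsingle _ (sub_nonneg.2 (G.rate_le_one s a ha)))
      (hsingle _ (by positivity))) (hsingle _ (mul_nonneg hrate (sub_nonneg.2 hsurvive)))
  p_sum s a _ := by
    simp only [Pi.add_apply, Finset.sum_add_distrib, Finset.sum_pi_single', Finset.mem_univ,
      if_true]
    ring
  target := G.target
  target_sink := G.edges_target

theorem appeal_eq (G : LossyGraph S) (π : S → S) (s a : S) :
    G.toMDP.appeal π s a = (1 - G.rate s a) * G.toMDP.val π s +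
      G.rate s a * (2⁻¹ ^ G.cost s a * G.toMDP.val π a) := by
  have hdead : G.toMDP.val π G.dead = 0 :=
    G.toMDP.val_of_sink G.edges_dead G.target_ne_dead.symm
  change ∑ s', (Pi.single s (1 - G.rate s a) + Pi.single a (G.rate s a * 2⁻¹ ^ G.cost s a) +
    Pi.single G.dead (G.rate s a * (1 - 2⁻¹ ^ G.cost s a)) : S → ℝ) s' * G.toMDP.val π s' = _
  simp only [Pi.add_apply, Pi.single_apply, add_mul, ite_mul, zero_mul, Finset.sum_add_distrib,
    Finset.sum_ite_eq', Finset.mem_univ, if_true, hdead, mul_zero, add_zero, mul_assoc]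

theorem IsDist.isPolicy (h : G.IsDist π D) : G.toMDP.IsPolicy π := h.mem_edges

theorem IsDist.val_eq_of_nonempty (h : G.IsDist π D) {s : S} (hs : (G.edges s).Nonempty) :
    G.toMDP.val π s = 2⁻¹ ^ G.cost s (π s) * G.toMDP.val π (π s) := by
  have hself := G.toMDP.appeal_self h.isPolicy hs
  rw [appeal_eq] at hself
  refine mul_left_cancel₀ (G.rate_pos s _ (h.mem_edges s hs)).ne' ?_
  linear_combination -hself

theorem IsDist.val_eq (h : G.IsDist π D) {s : S} (hs : s = G.target ∨ (G.edges s).Nonempty) :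
    G.toMDP.val π s = 2⁻¹ ^ D s := by
  refine h.path_induction (P := fun s ↦ G.toMDP.val π s = 2⁻¹ ^ D s) ?_ (fun s hs hval ↦ ?_) hs
  · rw [h.dist_target, zpow_zero]
    exact G.toMDP.val_target
  · rw [h.val_eq_of_nonempty hs, hval, h.dist_eq s hs, zpow_add₀ (by norm_num)]

theorem IsDist.appeal_eq (h : G.IsDist π D) {s a : S} (ha : a ∈ G.edges s) :
    G.toMDP.appeal π s a =
      G.toMDP.val π s + G.rate s a * (2⁻¹ ^ (G.cost s a + D a) - 2⁻¹ ^ D s) := by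
  rw [LossyGraph.appeal_eq, h.val_eq (.inr ⟨a, ha⟩), h.val_eq (G.dest_eq_target_or s a ha),
    zpow_add₀ (by norm_num)]
  ring

theorem IsDist.not_switchable (h : G.IsDist π D) {s : S}
    (hs : ∀ a ∈ G.edges s, D s ≤ G.cost s a + D a) : ¬ G.toMDP.Switchable π s := by
  rintro ⟨a, ha, hlt⟩
  rw [h.appeal_eq ha, lt_add_iff_pos_right, mul_pos_iff_of_pos_left (G.rate_pos s a ha), sub_pos,
    zpow_lt_zpow_iff_right_of_lt_one₀ (by norm_num) (by norm_num)] at hlt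
  exact hlt.not_ge (hs a ha)

theorem IsDist.not_isOptimal_of_lt (h : G.IsDist π D) {D' : S → ℤ} (h' : G.IsDist π' D') {s : S}
    (hs : (G.edges s).Nonempty) (hlt : D' s < D s) : ¬ G.toMDP.IsOptimal π := by
  intro hopt
  have hle := hopt.2 π' h'.isPolicy s
  rw [h.val_eq (.inr hs), h'.val_eq (.inr hs),
    zpow_le_zpow_iff_right_of_lt_one₀ (by norm_num) (by norm_num)] at hle
  exact hle.not_gt hlt

/-- The edge from `s` to `a` strictly shortens the path to the target, and no other edge competes
with it: each is no improvement, or has the same rate and is longer, or is so slow that its rate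
outweighs any saving. -/
structure IsBestEdge (G : LossyGraph S) (D : S → ℤ) (s a : S) : Prop where
  mem_edges : a ∈ G.edges s
  lt : G.cost s a + D a < D s
  best : ∀ b ∈ G.edges s, b ≠ a → D s ≤ G.cost s b + D b ∨
    (G.rate s b = G.rate s a ∧ G.cost s a + D a < G.cost s b + D b) ∨
    (G.rate s a = 1 ∧ G.rate s b < 2⁻¹ ^ D s)

theorem IsBestEdge.eq_of_greedyStep {s a : S} (ha : G.IsBestEdge D s a) (h : G.IsDist π D)
    (hstep : G.toMDP.GreedyStep π π') : π' s = a := by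
  have hpow {x y : ℤ} : (2⁻¹ : ℝ) ^ x < 2⁻¹ ^ y ↔ y < x :=
    zpow_lt_zpow_iff_right_of_lt_one₀ (by norm_num) (by norm_num)
  have hgain : (0 : ℝ) < 2⁻¹ ^ (G.cost s a + D a) - 2⁻¹ ^ D s := sub_pos.2 (hpow.2 ha.lt)
  have hrate := G.rate_pos s a ha.mem_edges
  refine hstep.eq_of_forall_appeal_lt ha.mem_edges ?_ fun b hb hne ↦ ?_
  · rw [h.appeal_eq ha.mem_edges]
    exact lt_add_of_pos_right _ (mul_pos hrate hgain)
  rw [h.appeal_eq ha.mem_edges, h.appeal_eq hb, add_lt_add_iff_left]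
  rcases ha.best b hb hne with hle | ⟨hrate', hlt⟩ | ⟨hone, hslow⟩
  · refine lt_of_le_of_lt (mul_nonpos_of_nonneg_of_nonpos (G.rate_pos s b hb).le ?_)
      (mul_pos hrate hgain)
    exact sub_nonpos.2 (not_lt.1 fun hlt ↦ (hpow.1 hlt).not_ge hle)
  · rw [hrate']
    exact mul_lt_mul_of_pos_left (sub_lt_sub_right (hpow.2 hlt) _) hrate
  · have hle_one : (2⁻¹ : ℝ) ^ (G.cost s b + D b) ≤ 1 := zpow_le_one₀ (by norm_num) (by norm_num)
      (add_nonneg (G.cost_pos s b hb).le (h.dist_nonneg (G.dest_eq_target_or s b hb)))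
    have hhalf : (2⁻¹ : ℝ) ^ (D s - 1) ≤ 2⁻¹ ^ (G.cost s a + D a) :=
      not_lt.1 fun hlt ↦ by have := hpow.1 hlt; have := ha.lt; omega
    have hpos : (0 : ℝ) < 2⁻¹ ^ D s := by positivity
    rw [zpow_sub_one₀ (by norm_num), inv_inv] at hhalf
    rw [hone, one_mul]
    nlinarith [G.rate_pos s b hb]

end LossyGraph

section Counter

/-- The number `C` with its bits below position `k` cleared. -/
def clearBelow (C k : ℕ) : ℕ := C / 2 ^ k * 2 ^ k

/-- The position of the lowest unset bit of `C`, which is the bit that an increment sets. -/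
noncomputable def lowestUnset (C : ℕ) : ℕ := sInf {i | C.testBit i = false}

/-- The lowest set bit of `C` at a position in `[k, n]`; it is `n` if there is none. -/
noncomputable def nextSet {n : ℕ} (C k : ℕ) : Fin (n + 1) :=
  sInf {j : Fin (n + 1) | k ≤ j ∧ C.testBit j}

variable {n C k m : ℕ}

theorem clearBelow_zero (C : ℕ) : clearBelow C 0 = C := by simp [clearBelow]

theorem lt_clearBelow_add (C k : ℕ) : C < clearBelow C k + 2 ^ k :=
  Nat.lt_div_mul_add (by positivity)

theorem clearBelow_eq_add (C k : ℕ) :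
    clearBelow C k = clearBelow C (k + 1) + if C.testBit k then 2 ^ k else 0 := by
  have hdiv : C / 2 ^ (k + 1) = C / 2 ^ k / 2 := by rw [pow_succ, Nat.div_div_eq_div_mul]
  rw [clearBelow, clearBelow, hdiv, Nat.testBit_eq_decide_div_mod_eq]
  simp only [decide_eq_true_eq]
  generalize C / 2 ^ k = q
  obtain ⟨d, rfl | rfl⟩ : ∃ d, q = 2 * d ∨ q = 2 * d + 1 := ⟨q / 2, by omega⟩
  · rw [if_neg (by omega), Nat.mul_div_cancel_left d two_pos]
    ring
  · rw [if_pos (by omega), show (2 * d + 1) / 2 = d by omega]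
    ring

theorem clearBelow_of_testBit (hk : C.testBit k) :
    clearBelow C k = clearBelow C (k + 1) + 2 ^ k := by
  rw [clearBelow_eq_add, if_pos hk]

theorem clearBelow_of_not_testBit (hk : ¬ C.testBit k) :
    clearBelow C k = clearBelow C (k + 1) := by
  rw [clearBelow_eq_add, if_neg hk, add_zero]

theorem clearBelow_antitone (C : ℕ) : Antitone (clearBelow C) :=
  antitone_nat_of_succ_le fun k ↦ (clearBelow_eq_add C k).symm ▸ Nat.le_add_right _ _

theorem not_testBit_lowestUnset (C : ℕ) : ¬ C.testBit (lowestUnset C) := by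
  have hmem : lowestUnset C ∈ {i | C.testBit i = false} :=
    Nat.sInf_mem ⟨C, Nat.testBit_lt_two_pow Nat.lt_two_pow_self⟩
  simpa using hmem

theorem testBit_of_lt_lowestUnset (hk : k < lowestUnset C) : C.testBit k := by
  simpa using Nat.notMem_of_lt_sInf hk

theorem lowestUnset_le (hk : ¬ C.testBit k) : lowestUnset C ≤ k :=
  Nat.sInf_le (by simpa using hk)

theorem add_one_eq_clearBelow_add (hk : k ≤ lowestUnset C) : C + 1 = clearBelow C k + 2 ^ k := by
  induction k with
  | zero => simp [clearBelow_zero]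
  | succ k ih =>
    have hset := clearBelow_of_testBit (testBit_of_lt_lowestUnset hk)
    have := ih (by omega)
    rw [pow_succ]
    omega

theorem add_one_eq_clearBelow_lowestUnset_add_one (C : ℕ) :
    C + 1 = clearBelow C (lowestUnset C + 1) + 2 ^ lowestUnset C := by
  rw [add_one_eq_clearBelow_add le_rfl, clearBelow_of_not_testBit (not_testBit_lowestUnset C)]

theorem testBit_add_one_iff :
    (C + 1).testBit k ↔ k = lowestUnset C ∨ lowestUnset C < k ∧ C.testBit k := by
  have heq := add_one_eq_clearBelow_lowestUnset_add_one C
  rw [clearBelow, mul_comm] at heq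
  rw [heq, Nat.testBit_two_pow_mul_add _ (Nat.pow_lt_pow_succ one_lt_two)]
  generalize lowestUnset C = i
  rcases lt_trichotomy k i with hk | rfl | hk
  · rw [if_pos (by omega), Nat.testBit_two_pow_of_ne (by omega)]
    simp only [Bool.false_eq_true, false_iff]
    omega
  · simp
  · rw [if_neg (by omega), Nat.testBit_div_two_pow, Nat.sub_add_cancel hk]
    simp [hk, hk.ne']

theorem clearBelow_add_one_of_lowestUnset_lt (hk : lowestUnset C < k) :
    clearBelow (C + 1) k = clearBelow C k := by
  rw [clearBelow, clearBelow]
  congr 1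
  refine Nat.eq_of_testBit_eq fun j ↦ Bool.eq_iff_iff.2 ?_
  rw [Nat.testBit_div_two_pow, Nat.testBit_div_two_pow, testBit_add_one_iff]
  constructor
  · rintro (h | h)
    exacts [by omega, h.2]
  · exact fun h ↦ .inr ⟨by omega, h⟩

theorem add_one_lt_two_pow_of_lowestUnset_lt (hC : C < 2 ^ n) (h : lowestUnset C < n) :
    C + 1 < 2 ^ n := by
  refine Nat.lt_of_le_of_ne hC fun heq ↦ ?_
  have htop : (C + 1).testBit n := heq ▸ Nat.testBit_two_pow_self
  rcases testBit_add_one_iff.1 htop with rfl | ⟨-, hn⟩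
  · exact h.ne rfl
  · exact absurd (Nat.testBit_lt_two_pow hC) (by simp [hn])

theorem testBit_of_two_pow_le_of_lt (hle : 2 ^ n ≤ C) (hlt : C < 2 ^ (n + 1)) : C.testBit n := by
  rw [Nat.testBit_eq_decide_div_mod_eq, Nat.div_eq_of_lt_le (k := 1) (by omega) (by omega)]
  rfl

theorem nextSet_mem (hC : C.testBit n) (hk : k ≤ n) :
    k ≤ (nextSet C k : Fin (n + 1)) ∧ C.testBit (nextSet C k : Fin (n + 1)) := by
  have hne : {j : Fin (n + 1) | k ≤ j ∧ C.testBit j}.Nonempty := ⟨Fin.last n, hk, by simpa⟩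
  exact hne.csInf_mem (Set.toFinite _)

theorem nextSet_le {j : Fin (n + 1)} (hk : k ≤ j) (hj : C.testBit j) : nextSet C k ≤ j :=
  sInf_le ⟨hk, hj⟩

theorem nextSet_add_one_of_le (hC : (C + 1).testBit n) (hk : k ≤ lowestUnset C) :
    ((nextSet (C + 1) k : Fin (n + 1)) : ℕ) = lowestUnset C := by
  have hi : lowestUnset C ≤ n := (testBit_add_one_iff.1 hC).elim Eq.ge fun h ↦ h.1.le
  have hle : nextSet (C + 1) k ≤ (⟨lowestUnset C, Nat.lt_succ_of_le hi⟩ : Fin (n + 1)) :=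
    nextSet_le hk (testBit_add_one_iff.2 (.inl rfl))
  refine le_antisymm hle ?_
  rcases testBit_add_one_iff.1 (nextSet_mem hC (hk.trans hi)).2 with h | h
  exacts [h.ge, h.1.le]

theorem nextSet_add_one_of_lt (hk : lowestUnset C < k) :
    (nextSet (C + 1) k : Fin (n + 1)) = nextSet C k := by
  have hset : {j : Fin (n + 1) | k ≤ j ∧ (C + 1).testBit j} =
      {j : Fin (n + 1) | k ≤ j ∧ C.testBit j} := by
    ext j
    simp only [Set.mem_ofPred_eq, testBit_add_one_iff]
    refine and_congr_right fun hj ↦ ⟨?_, fun h ↦ .inr ⟨by omega, h⟩⟩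
    rintro (h | h)
    exacts [by omega, h.2]
  rw [nextSet, nextSet, hset]

theorem clearBelow_eq_of_forall_not_testBit (hkm : k ≤ m)
    (h : ∀ j, k ≤ j → j < m → ¬ C.testBit j) : clearBelow C m = clearBelow C k := by
  induction m, hkm using Nat.le_induction with
  | base => rfl
  | succ m hm ih =>
    rw [← ih fun j hj hjm ↦ h j hj (by omega), clearBelow_of_not_testBit (h m hm (by omega))]

theorem clearBelow_nextSet (hC : C.testBit n) (hk : k ≤ n) :
    clearBelow C (nextSet C k : Fin (n + 1)) = clearBelow C k :=
  clearBelow_eq_of_forall_not_testBit (nextSet_mem hC hk).1 fun j hj hlt hbit ↦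
    hlt.not_ge (nextSet_le (j := ⟨j, by omega⟩) hj hbit)

theorem clearBelow_nextSet_add (hC : C.testBit n) (hk : k ≤ n) :
    clearBelow C ((nextSet C k : Fin (n + 1)) + 1) + 2 ^ ((nextSet C k : Fin (n + 1)) : ℕ) =
      clearBelow C k := by
  rw [← clearBelow_of_testBit (nextSet_mem hC hk).2, clearBelow_nextSet hC hk]

theorem clearBelow_lt_of_ne_nextSet (hC : C.testBit n) {j : Fin (n + 1)} (hk : k ≤ j)
    (hbit : C.testBit j) (hj : j ≠ nextSet C k) : clearBelow C j < clearBelow C k := by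
  have hlt : nextSet C k < j := (nextSet_le hk hbit).lt_of_ne hj.symm
  calc clearBelow C j
    _ ≤ clearBelow C ((nextSet C k : Fin (n + 1)) + 1) := clearBelow_antitone C hlt
    _ < clearBelow C ((nextSet C k : Fin (n + 1)) + 1) + 2 ^ ((nextSet C k : Fin (n + 1)) : ℕ) :=
      Nat.lt_add_of_pos_right (by positivity)
    _ = clearBelow C k := clearBelow_nextSet_add hC (by omega)

end Counter

/-- `code W` turns lexicographically ordered pairs into integers; it is additive, and it preserves
the order of pairs whose second components differ by less than `W`. -/
def code (W : ℤ) : ℤ ×ₗ ℤ →+ ℤ where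
  toFun x := W * (ofLex x).1 + (ofLex x).2
  map_zero' := by simp
  map_add' x y := by simp only [ofLex_add, Prod.fst_add, Prod.snd_add]; ring

theorem code_toLex (W x y : ℤ) : code W (toLex (x, y)) = W * x + y := rfl

theorem code_lt_code {W : ℤ} {x y : ℤ ×ₗ ℤ} (h : x < y) (hlo : (ofLex x).2 < (ofLex y).2 + W)
    (hW : 0 ≤ W) : code W x < code W y := by
  obtain ⟨⟨a, b⟩, rfl⟩ := toLex.surjective x
  obtain ⟨⟨c, d⟩, rfl⟩ := toLex.surjective y
  rw [code_toLex, code_toLex]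
  simp only [ofLex_toLex] at hlo
  rcases Prod.Lex.toLex_lt_toLex.1 h with hlt | ⟨heq, hlt⟩
  · have : W * (a + 1) ≤ W * c := mul_le_mul_of_nonneg_left hlt hW
    linarith
  · simp only at heq hlt
    rw [heq]
    linarith

theorem code_le_code {W : ℤ} {x y : ℤ ×ₗ ℤ} (h : x ≤ y) (hlo : (ofLex x).2 < (ofLex y).2 + W)
    (hW : 0 ≤ W) : code W x ≤ code W y :=
  h.eq_or_lt.elim (fun heq ↦ heq ▸ le_rfl) fun hlt ↦ (code_lt_code hlt hlo hW).le

theorem two_mul_two_pow_le {k m : ℕ} (h : k < m) : 2 * 2 ^ k ≤ 2 ^ m := by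
  rw [mul_comm, ← pow_succ]
  exact Nat.pow_le_pow_right two_pos h

theorem toLex_add_toLex (a b c d : ℤ) : toLex (a, b) + toLex (c, d) = toLex (a + c, b + d) := rfl

theorem toLex_sub_toLex (a b c d : ℤ) : toLex (a, b) - toLex (c, d) = toLex (a - c, b - d) := rfl

/-- The nodes of the counter graph with bits `0, …, n`. The binary counter is stored at the nodes
`bit k`; `high k` is an entry to the bits `≥ k`; the lanes form a clock, which delays the increments
of the counter; the `pad` nodes are sinks which only serve to adjust the number of nodes. -/
inductive CounterNode (n r : ℕ)
  | hub
  | lane (l : Fin (2 * n + 1))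
  | high (k : Fin (n + 1))
  | bit (k : Fin (n + 1))
  | pad (j : Fin (r + 1))
  deriving DecidableEq

namespace CounterNode

variable {n r C t : ℕ}

/-- The nodes sorted by kind; this is how they are counted. -/
def equivSum (n r : ℕ) : CounterNode n r ≃
    Unit ⊕ Fin (2 * n + 1) ⊕ Fin (n + 1) ⊕ Fin (n + 1) ⊕ Fin (r + 1) where
  toFun
    | hub => .inl ()
    | lane l => .inr (.inl l)
    | high k => .inr (.inr (.inl k))
    | bit k => .inr (.inr (.inr (.inl k)))
    | pad j => .inr (.inr (.inr (.inr j)))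
  invFun
    | .inl () => hub
    | .inr (.inl l) => lane l
    | .inr (.inr (.inl k)) => high k
    | .inr (.inr (.inr (.inl k))) => bit k
    | .inr (.inr (.inr (.inr j))) => pad j
  left_inv s := by cases s <;> rfl
  right_inv s := by rcases s with _ | _ | _ | _ | _ <;> rfl

instance : Fintype (CounterNode n r) := .ofEquiv _ (equivSum n r).symm

theorem card_eq (n r : ℕ) : Fintype.card (CounterNode n r) = 4 * n + r + 5 := by
  rw [Fintype.card_congr (equivSum n r)]
  simp only [Fintype.card_sum, Fintype.card_unit, Fintype.card_fin]
  ring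

/-- The edges of the counter graph. -/
def Edge : CounterNode n r → CounterNode n r → Prop
  | hub, bit _ => True
  | lane l, high _ => (l : ℕ) = 0
  | lane l, hub => (l : ℕ) ≠ 0
  | lane l, lane l' => (l : ℕ) = l' + 1
  | high k, bit j => j = k
  | high k, high m => k < m
  | bit k, hub => (k : ℕ) < n
  | bit k, lane l => (k : ℕ) < n ∧ (l : ℕ) ≤ 2 * k
  | bit k, high m => k < m
  | _, _ => False

/-- The edges that are traversed at a small rate. -/
def Slow : CounterNode n r → CounterNode n r → Prop
  | bit _, high _ => True
  | _, _ => False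

/-- The length of an edge, up to `potential`, as a pair of loss and delay. -/
def len : CounterNode n r → CounterNode n r → ℤ ×ₗ ℤ
  | lane _, hub => toLex (0, 6 * n + 1)
  | lane _, lane _ => toLex (0, 1)
  | high _, high _ => toLex (0, 1)
  | bit k, high _ => toLex (-(2 ^ (k : ℕ) : ℕ), 0)
  | bit k, hub => toLex ((2 ^ (k : ℕ) : ℕ) - 1, 6 * n + 2)
  | bit k, lane l => toLex ((2 ^ (k : ℕ) : ℕ) - 1, 6 * n + 1 - 2 * l)
  | _, _ => toLex (0, 0)

/-- A potential that makes all lengths positive. -/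
def potential : CounterNode n r → ℤ ×ₗ ℤ
  | hub | lane _ => toLex (1 - (2 ^ (n + 1) : ℕ), -2 * n - 2)
  | high k => toLex ((2 ^ (k : ℕ) : ℕ) - (2 ^ (n + 1) : ℕ), 2 * k - 1 - 2 * n)
  | bit k => toLex ((2 ^ (k : ℕ) : ℕ) - (2 ^ (n + 1) : ℕ), 2 * k - 2 * n)
  | pad _ => toLex (0, 0)

/-- An upper bound on the differences of the delays that have to be compared. -/
abbrev scale (n : ℕ) : ℤ := 12 * n + 5

theorem code_len_pos {s s' : CounterNode n r} (h : Edge s s') :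
    0 < code (scale n) (len s s' + potential s' - potential s) := by
  have hcode {x y : ℤ} (hx : 0 ≤ x) (hy : 0 < y) : 0 < code (scale n) (toLex (x, y)) := by
    rw [code_toLex]
    positivity
  have hpos (m : ℕ) : 0 < 2 ^ m := by positivity
  rcases s with _ | l | k | k | j <;> rcases s' with _ | l' | m | m | j' <;>
    simp only [Edge] at h <;>
    simp only [len, potential, toLex_add_toLex, toLex_sub_toLex] <;>
    apply hcode
  all_goals first
    | omega
    | subst h; omega
    | have := hpos m; omega
    | have := two_mul_two_pow_le h; omega

/-- At phase `(C, t)` the counter stores `C` and the clock has advanced to `t`.  This predicate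
says that the clock has run out: the increment is being carried out. -/
abbrev Late (C t : ℕ) : Prop := t = 2 * lowestUnset C + 3

/-- In phase `(C, t)` the node `high k` leads to `bit k`. -/
abbrev IsEntry (C t k : ℕ) : Prop := C.testBit k ∨ k = lowestUnset C ∧ Late C t

/-- In phase `(C, t)` the node `bit k` stores a set bit, that is, it leads to higher bits. -/
abbrev IsSet (C t k : ℕ) : Prop := C.testBit k ∨ k = lowestUnset C ∧ 2 * lowestUnset C + 2 ≤ t

/-- The value of the counter as seen from the hub. -/
noncomputable abbrev hubValue (C t : ℕ) : ℕ := if Late C t then C + 1 else C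

theorem le_hubValue (C t : ℕ) : C ≤ hubValue C t := by
  unfold hubValue
  split_ifs <;> omega

/-- The policy of phase `(C, t)`. -/
noncomputable def phasePolicy (C t : ℕ) : CounterNode n r → CounterNode n r
  | hub => bit (nextSet (hubValue C t) 0)
  | lane ⟨0, _⟩ => high (nextSet C 0)
  | lane ⟨l + 1, hl⟩ => if l + 1 ≤ t then lane ⟨l, by omega⟩ else hub
  | high k => if IsEntry C t k then bit k else high (nextSet C (k + 1))
  | bit k =>
    if IsSet C t k then high (nextSet C (k + 1))
    else if t = 0 then hub else lane ⟨min (t - 1) (2 * n), by omega⟩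
  | pad j => pad j

/-- The distance to `bit n` in phase `(C, t)`, up to `potential`, as a pair of loss and delay. -/
noncomputable def dist (C t : ℕ) : CounterNode n r → ℤ ×ₗ ℤ
  | hub => toLex (-hubValue C t, 0)
  | lane l => if l ≤ t then toLex (-C, l) else toLex (-hubValue C t, 6 * n + 1)
  | high k =>
    if IsEntry C t k then toLex (-(clearBelow C (k + 1) + 2 ^ (k : ℕ) : ℕ), 0)
    else toLex (-clearBelow C (k + 1), 1)
  | bit k =>
    if IsSet C t k then toLex (-(clearBelow C (k + 1) + 2 ^ (k : ℕ) : ℕ), 0)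
    else toLex ((2 ^ (k : ℕ) : ℕ) - 1 - C, 6 * n + 2 - t)
  | pad _ => toLex (0, 0)

/-- The distance to `bit n` in phase `(C, t)` when the edge from `s` to `a` is taken first. -/
noncomputable def via (C t : ℕ) (s a : CounterNode n r) : ℤ ×ₗ ℤ := len s a + dist C t a

/-- The phases that occur when the counter runs from `2 ^ n` to `2 ^ (n + 1) - 1`. The top bit is
always set, so that every position has a next set bit above it. -/
structure IsPhase (n C t : ℕ) : Prop where
  two_pow_le : 2 ^ n ≤ C
  lt_two_pow : C < 2 ^ (n + 1)
  clock_le_lowestUnset : t ≤ 2 * lowestUnset C + 3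
  clock_le : t ≤ 2 * n + 1

theorem IsPhase.testBit_top (h : IsPhase n C t) : C.testBit n :=
  testBit_of_two_pow_le_of_lt h.two_pow_le h.lt_two_pow

theorem IsPhase.lowestUnset_lt (h : IsPhase n C t) (hlate : Late C t) : lowestUnset C < n := by
  have := h.clock_le
  omega

theorem IsPhase.hubValue_testBit_top (h : IsPhase n C t) : (hubValue C t).testBit n := by
  unfold hubValue
  split_ifs with hlate
  · exact testBit_add_one_iff.2 (.inr ⟨h.lowestUnset_lt hlate, h.testBit_top⟩)
  · exact h.testBit_top

theorem IsPhase.isSet_nextSet_hubValue (h : IsPhase n C t) :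
    IsSet C t (nextSet (hubValue C t) 0 : Fin (n + 1)) ∧
    clearBelow C ((nextSet (hubValue C t) 0 : Fin (n + 1)) + 1) +
      2 ^ ((nextSet (hubValue C t) 0 : Fin (n + 1)) : ℕ) = hubValue C t := by
  have htop := h.hubValue_testBit_top
  by_cases hlate : Late C t
  · simp only [hubValue, if_pos hlate] at htop ⊢
    rw [nextSet_add_one_of_le htop (Nat.zero_le _)]
    exact ⟨.inr ⟨rfl, by omega⟩, (add_one_eq_clearBelow_lowestUnset_add_one C).symm⟩
  · simp only [hubValue, if_neg hlate] at htop ⊢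
    exact ⟨.inl (nextSet_mem htop (Nat.zero_le _)).2,
      (clearBelow_nextSet_add htop (Nat.zero_le _)).trans (clearBelow_zero C)⟩

theorem dist_hub_eq (h : IsPhase n C t) :
    dist C t (hub : CounterNode n r) = via (n := n) (r := r) C t hub (phasePolicy C t hub) := by
  obtain ⟨hset, hval⟩ := h.isSet_nextSet_hubValue
  simp only [via, phasePolicy, dist, len, if_pos hset, hval, toLex_add_toLex, zero_add]

theorem dist_high_nextSet (h : IsPhase n C t) {k : ℕ} (hk : k ≤ n) :
    dist C t (high (nextSet C k) : CounterNode n r) = toLex (-(clearBelow C k : ℤ), 0) := by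
  have hmem := nextSet_mem h.testBit_top hk
  simp only [dist, if_pos (show IsEntry C t _ from .inl hmem.2),
    clearBelow_nextSet_add h.testBit_top hk]

theorem dist_lane_eq (h : IsPhase n C t) (l : Fin (2 * n + 1)) :
    dist C t (lane l : CounterNode n r) =
      via (n := n) (r := r) C t (lane l) (phasePolicy C t (lane l)) := by
  rcases l with ⟨_ | l, hl⟩
  · simp only [via, phasePolicy, dist_high_nextSet h (Nat.zero_le n), clearBelow_zero]
    simp only [dist, len, toLex_add_toLex, Nat.zero_le, if_true, zero_add, Nat.cast_zero]
  · by_cases hlt : l + 1 ≤ t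
    · simp only [via, phasePolicy, dist, len, if_pos hlt, if_pos (Nat.le_of_succ_le hlt),
        toLex_add_toLex, zero_add, Nat.cast_succ, add_comm (1 : ℤ)]
    · simp only [via, phasePolicy, dist, len, if_neg hlt, toLex_add_toLex, zero_add, add_zero]

theorem IsPhase.lt_of_not_testBit (h : IsPhase n C t) {k : Fin (n + 1)} (hk : ¬ C.testBit k) :
    (k : ℕ) < n :=
  (Nat.le_of_lt_succ k.2).lt_of_ne fun heq ↦ hk (by rw [heq]; exact h.testBit_top)

theorem dist_high_eq (h : IsPhase n C t) (k : Fin (n + 1)) :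
    dist C t (high k : CounterNode n r) =
      via (n := n) (r := r) C t (high k) (phasePolicy C t (high k)) := by
  by_cases hentry : IsEntry C t k
  · have hset : IsSet C t k := hentry.imp_right fun hk ↦ ⟨hk.1, by omega⟩
    simp only [via, phasePolicy, if_pos hentry, dist, len, if_pos hset, toLex_add_toLex, zero_add]
  · have hk : (k : ℕ) < n := h.lt_of_not_testBit (not_or.1 hentry).1
    simp only [via, phasePolicy, if_neg hentry, dist_high_nextSet h (k := k + 1) hk]
    simp only [dist, if_neg hentry, len, toLex_add_toLex, zero_add, add_zero]

theorem dist_bit_eq (h : IsPhase n C t) (k : Fin (n + 1)) (hk : (k : ℕ) < n) :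
    dist C t (bit k : CounterNode n r) =
      via (n := n) (r := r) C t (bit k) (phasePolicy C t (bit k)) := by
  by_cases hset : IsSet C t k
  · simp only [via, phasePolicy, if_pos hset, dist_high_nextSet h (k := k + 1) hk]
    simp only [dist, if_pos hset, len, toLex_add_toLex, toLex_inj, Prod.mk.injEq]
    omega
  · have := h.clock_le
    rcases t with _ | t
    · simp only [via, phasePolicy, dist, len, if_neg hset, if_true, toLex_add_toLex, toLex_inj,
        Prod.mk.injEq, hubValue, if_neg (show ¬ Late C 0 by omega)]
      omega
    · simp only [via, phasePolicy, dist, len, if_neg hset, Nat.add_one_sub_one, toLex_add_toLex,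
        if_neg t.add_one_ne_zero, if_pos (show min t (2 * n) ≤ t + 1 by omega), toLex_inj,
        Prod.mk.injEq]
      omega

theorem lt_of_edge_bit {k : Fin (n + 1)} {s' : CounterNode n r} (h : Edge (bit k) s') :
    (k : ℕ) < n := by
  rcases s' with _ | l | m | m | j <;> simp only [Edge] at h <;> omega

theorem dist_eq_via_phasePolicy (h : IsPhase n C t) {s s' : CounterNode n r} (hs : Edge s s') :
    dist C t s = via C t s (phasePolicy C t s) := by
  rcases s with _ | l | k | k | j
  · exact dist_hub_eq h
  · exact dist_lane_eq h l
  · exact dist_high_eq h k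
  · exact dist_bit_eq h k (lt_of_edge_bit hs)
  · exact hs.elim

theorem edge_phasePolicy (h : IsPhase n C t) {s s' : CounterNode n r} (hs : Edge s s') :
    Edge s (phasePolicy C t s) := by
  have hnext {k : ℕ} (hk : k < n) : k < (nextSet C (k + 1) : Fin (n + 1)) :=
    (nextSet_mem h.testBit_top hk).1
  rcases s with _ | ⟨_ | l, hl⟩ | k | k | j
  · trivial
  · rfl
  · simp only [phasePolicy]
    split_ifs <;> simp [Edge]
  · simp only [phasePolicy]
    split_ifs with hentry
    · rfl
    · exact hnext (h.lt_of_not_testBit (not_or.1 hentry).1)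
  · have hk := lt_of_edge_bit hs
    simp only [phasePolicy]
    split_ifs with hset ht
    · exact hnext hk
    · exact hk
    · rw [not_or] at hset
      have := lowestUnset_le hset.1
      have := h.clock_le_lowestUnset
      exact ⟨hk, by dsimp only; omega⟩
  · exact hs.elim

theorem delay_dist_nonneg (h : IsPhase n C t) (s : CounterNode n r) :
    0 ≤ (ofLex (dist C t s)).2 := by
  have := h.clock_le
  rcases s with _ | l | k | k | j <;> simp only [dist] <;> (try split_ifs) <;>
    simp only [ofLex_toLex] <;> omega

theorem delay_dist_le (s : CounterNode n r) : (ofLex (dist C t s)).2 ≤ 6 * n + 2 := by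
  rcases s with _ | l | k | k | j <;> simp only [dist] <;> (try split_ifs) <;>
    simp only [ofLex_toLex] <;> omega

theorem delay_len_nonneg (s s' : CounterNode n r) : 0 ≤ (ofLex (len s s')).2 := by
  rcases s with _ | l | k | k | j <;> rcases s' with _ | l' | m | m | j' <;>
    simp only [len, ofLex_toLex] <;> omega

theorem delay_len_le (s s' : CounterNode n r) : (ofLex (len s s')).2 ≤ 6 * n + 2 := by
  rcases s with _ | l | k | k | j <;> rcases s' with _ | l' | m | m | j' <;>
    simp only [len, ofLex_toLex] <;> omega

theorem delay_via_nonneg (h : IsPhase n C t) (s s' : CounterNode n r) :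
    0 ≤ (ofLex (via C t s s')).2 :=
  add_nonneg (delay_len_nonneg s s') (delay_dist_nonneg h s')

theorem delay_via_lt_scale (s s' : CounterNode n r) : (ofLex (via C t s s')).2 < scale n := by
  have hlen := delay_len_le s s'
  have hdist := delay_dist_le (C := C) (t := t) s'
  change (ofLex (len s s')).2 + (ofLex (dist C t s')).2 < 12 * n + 5
  omega

/-- A strict upper bound on the distances in all phases. -/
abbrev distBound (n : ℕ) : ℤ := scale n * ((2 ^ (n + 1) : ℕ) + 1)

theorem code_dist_sub_potential_lt (s : CounterNode n r) :
    code (scale n) (dist C t s - potential s) < distBound n := by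
  have hpos (m : ℕ) : 0 < 2 ^ m := by positivity
  have hcode {x y : ℤ} (hx : x ≤ (2 ^ (n + 1) : ℕ)) (hy : y < 12 * n + 5) :
      code (scale n) (toLex (x, y)) < distBound n := by
    have : scale n * x ≤ scale n * (2 ^ (n + 1) : ℕ) := mul_le_mul_of_nonneg_left hx (by positivity)
    rw [code_toLex, distBound, mul_add, mul_one]
    exact add_lt_add_of_le_of_lt this hy
  rcases s with _ | l | k | k | j <;> simp only [dist] <;> (try split_ifs) <;>
    simp only [potential, toLex_sub_toLex] <;> apply hcode
  all_goals first
    | omega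
    | have := hpos k; omega
    | have := hpos (n + 1); omega

open scoped Classical in
/-- The lossy graph of a counter with bits `0, …, n`. The slow edges are so slow that no improvement
in value makes up for it, so that they are selected only when they are the only improvement. -/
noncomputable def counterGraph (n r : ℕ) : LossyGraph (CounterNode n r) where
  edges s := {s' | Edge s s'}
  cost s s' := code (scale n) (len s s' + potential s' - potential s)
  rate s s' := if Slow s s' then 2⁻¹ ^ distBound n else 1
  target := bit (Fin.last n)
  dead := pad 0
  cost_pos s s' h := code_len_pos (by simpa using h)
  rate_pos s s' _ := by split_ifs <;> positivity
  rate_le_one s s' _ := by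
    split_ifs
    · exact zpow_le_one₀ (by norm_num) (by norm_num) (by positivity)
    · exact le_rfl
  edges_target := Finset.filter_eq_empty_iff.2 fun s' _ h ↦ (lt_of_edge_bit h).ne rfl
  edges_dead := Finset.filter_eq_empty_iff.2 fun s' _ h ↦ h
  target_ne_dead := by simp
  dest_eq_target_or s s' h := by
    simp only [Finset.mem_filter_univ] at h
    have hlast (k : Fin (n + 1)) (hk : k ≠ Fin.last n) : (k : ℕ) < n := Fin.val_lt_last hk
    rcases s' with _ | l | k | k | j
    · exact .inr ⟨bit 0, by simp [Edge]⟩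
    · by_cases hl : (l : ℕ) = 0
      · exact .inr ⟨high 0, by simpa [Edge] using hl⟩
      · exact .inr ⟨hub, by simpa [Edge] using hl⟩
    · exact .inr ⟨bit k, by simp [Edge]⟩
    · exact or_iff_not_imp_left.2 fun hk ↦ ⟨hub, by simpa [Edge] using hlast k (by simpa using hk)⟩
    · cases s <;> exact h.elim

theorem mem_edges_counterGraph {s s' : CounterNode n r} :
    s' ∈ (counterGraph n r).edges s ↔ Edge s s' := by
  simp [counterGraph]

theorem edges_counterGraph_nonempty {s : CounterNode n r} :
    ((counterGraph n r).edges s).Nonempty ↔ ∃ s', Edge s s' :=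
  exists_congr fun _ ↦ mem_edges_counterGraph

/-- The distance to the target of `counterGraph n r` in phase `(C, t)`. -/
noncomputable def codedDist (C t : ℕ) (s : CounterNode n r) : ℤ :=
  code (scale n) (dist C t s - potential s)

/-- `π` is the policy of phase `(C, t)`, except possibly at the sinks. -/
def Follows (π : CounterNode n r → CounterNode n r) (C t : ℕ) : Prop :=
  ∀ s s', Edge s s' → π s = phasePolicy C t s

theorem cost_add_codedDist (s s' : CounterNode n r) :
    (counterGraph n r).cost s s' + codedDist C t s' =
      code (scale n) (via C t s s') - code (scale n) (potential s) := by
  rw [codedDist, via, counterGraph, ← map_sub, ← map_add]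
  congr 1
  abel

variable {π π' : CounterNode n r → CounterNode n r}

theorem Follows.isDist (hπ : Follows π C t) (h : IsPhase n C t) :
    (counterGraph n r).IsDist π (codedDist C t) where
  mem_edges s hs := by
    obtain ⟨s', hs'⟩ := edges_counterGraph_nonempty.1 hs
    rw [mem_edges_counterGraph, hπ s s' hs']
    exact edge_phasePolicy h hs'
  dist_target := by
    have hset : IsSet C t n := .inl h.testBit_top
    have hclear : clearBelow C (n + 1) = 0 := by simp [clearBelow, Nat.div_eq_of_lt h.lt_two_pow]
    have hdist : dist C t (counterGraph n r).target = potential (counterGraph n r).target := by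
      change dist C t (bit (Fin.last n)) = potential (bit (Fin.last n))
      simp only [dist, potential, if_pos hset, Fin.val_last, hclear, toLex_inj, Prod.mk.injEq]
      omega
    exact (congrArg _ (sub_eq_zero.2 hdist)).trans (map_zero _)
  dist_eq s hs := by
    obtain ⟨s', hs'⟩ := edges_counterGraph_nonempty.1 hs
    rw [cost_add_codedDist, hπ s s' hs', ← dist_eq_via_phasePolicy h hs', codedDist, map_sub]

/-- The edge from `s` to `a` does not improve on the path that is taken in phase `(C, t)`. -/
def NoGain (C t : ℕ) (s a : CounterNode n r) : Prop := dist C t s ≤ via C t s a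

/-- No edge out of `s` improves on the path that is taken in phase `(C, t)`. -/
def IsSettled (C t : ℕ) (s : CounterNode n r) : Prop := ∀ a, Edge s a → NoGain C t s a

/-- In phase `(C, t)`, the edge from `s` to `a` is the one that a greedy step selects. -/
structure IsBestSwitch (C t : ℕ) (s a : CounterNode n r) : Prop where
  edge : Edge s a
  lt : via C t s a < dist C t s
  best : ∀ b, Edge s b → b ≠ a → NoGain C t s b ∨
    ((Slow s b ↔ Slow s a) ∧ via C t s a < via C t s b) ∨ ¬ Slow s a ∧ Slow s b

theorem NoGain.codedDist_le {s s' : CounterNode n r} (hle : NoGain C t s s')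
    (h : IsPhase n C t) :
    codedDist C t s ≤ (counterGraph n r).cost s s' + codedDist C t s' := by
  rw [cost_add_codedDist, codedDist, map_sub, sub_le_sub_iff_right]
  refine code_le_code hle ?_ (by positivity)
  have := delay_dist_le (C := C) (t := t) s
  have := delay_via_nonneg h s s'
  rw [scale]
  omega

theorem IsSettled.not_switchable {s : CounterNode n r} (hs : IsSettled C t s)
    (hπ : Follows π C t) (h : IsPhase n C t) : ¬ (counterGraph n r).toMDP.Switchable π s :=
  (hπ.isDist h).not_switchable fun s' hs' ↦
    (hs s' (mem_edges_counterGraph.1 hs')).codedDist_le h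

theorem IsBestSwitch.isBestEdge {s a : CounterNode n r} (hs : IsBestSwitch C t s a)
    (h : IsPhase n C t) : (counterGraph n r).IsBestEdge (codedDist C t) s a where
  mem_edges := mem_edges_counterGraph.2 hs.edge
  lt := by
    rw [cost_add_codedDist, codedDist, map_sub, sub_lt_sub_iff_right]
    refine code_lt_code hs.lt ?_ (by positivity)
    exact (delay_via_lt_scale s a).trans_le (le_add_of_nonneg_left (delay_dist_nonneg h s))
  best b hb hne := by
    rcases hs.best b (mem_edges_counterGraph.1 hb) hne with hle | ⟨hslow, hlt⟩ | ⟨hfast, hslow⟩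
    · exact .inl (hle.codedDist_le h)
    · refine .inr (.inl ⟨by classical exact if_congr hslow rfl rfl, ?_⟩)
      rw [cost_add_codedDist, cost_add_codedDist, sub_lt_sub_iff_right]
      refine code_lt_code hlt ?_ (by positivity)
      exact (delay_via_lt_scale s a).trans_le (le_add_of_nonneg_left (delay_via_nonneg h s b))
    · refine .inr (.inr ⟨if_neg hfast, ?_⟩)
      exact (if_pos hslow).trans_lt (zpow_lt_zpow_right_of_lt_one₀ (by norm_num) (by norm_num)
        (code_dist_sub_potential_lt s))

/-- In a greedy step from phase `(C, t)`, the node `s` takes up the action of phase `(C', t')`. -/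
def StepsTo (C t C' t' : ℕ) (s : CounterNode n r) : Prop :=
  IsSettled C t s ∧ phasePolicy C t s = phasePolicy C' t' s ∨
    IsBestSwitch C t s (phasePolicy C' t' s)

theorem Follows.greedyStep {C' t' : ℕ} (hπ : Follows π C t) (h : IsPhase n C t)
    (hsteps : ∀ s s' : CounterNode n r, Edge s s' → StepsTo C t C' t' s)
    (hstep : (counterGraph n r).toMDP.GreedyStep π π') : Follows π' C' t' := by
  intro s s' hs
  rcases hsteps s s' hs with ⟨hsettled, heq⟩ | hbest
  · rw [(hstep s).2 (hsettled.not_switchable hπ h), hπ s s' hs, heq]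
  · exact (hbest.isBestEdge h).eq_of_greedyStep (hπ.isDist h) hstep

theorem isBestSwitch_of_forall_ne {s a : CounterNode n r} (hedge : Edge s a)
    (hlt : via C t s a < dist C t s) (hle : ∀ b, Edge s b → b ≠ a → NoGain C t s b) :
    IsBestSwitch C t s a :=
  ⟨hedge, hlt, fun b hb hne ↦ .inl (hle b hb hne)⟩

theorem clearBelow_add_two_pow_le {j k : ℕ} (hk : C.testBit k) (hjk : j ≤ k) :
    clearBelow C (k + 1) + 2 ^ k ≤ clearBelow C j := by
  rw [← clearBelow_of_testBit hk]
  exact clearBelow_antitone C hjk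

theorem eq_bit_of_edge_hub {s' : CounterNode n r} (h : Edge hub s') : ∃ k, s' = bit k := by
  rcases s' with _ | l | m | m | j <;> first | exact h.elim | exact ⟨_, rfl⟩

theorem noGain_hub_bit (h : IsPhase n C t) {j : Fin (n + 1)}
    (hj : (j : ℕ) = lowestUnset C → t ≠ 2 * lowestUnset C + 2) :
    NoGain C t (hub : CounterNode n r) (bit j) := by
  have hclock := h.clock_le
  have hle := le_hubValue C t
  have hpos : 0 < 2 ^ (j : ℕ) := by positivity
  by_cases hset : IsSet C t j
  · simp only [NoGain, dist, via, len, if_pos hset, toLex_add_toLex, Prod.Lex.toLex_le_toLex]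
    rcases hset with hbit | ⟨heq, ht⟩
    · have := clearBelow_add_two_pow_le hbit (Nat.zero_le _)
      rw [clearBelow_zero] at this
      omega
    · have := add_one_eq_clearBelow_lowestUnset_add_one C
      have hlate : Late C t := by
        have := h.clock_le_lowestUnset
        have := hj heq
        omega
      rw [hubValue, if_pos hlate, heq]
      omega
  · simp only [NoGain, dist, via, len, if_neg hset, toLex_add_toLex, Prod.Lex.toLex_le_toLex]
    omega

theorem stepsTo_hub_advance (h : IsPhase n C t) (hlate : ¬ Late C t) (ht : t ≤ 2 * n) :
    StepsTo C t C (t + 1) (hub : CounterNode n r) := by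
  by_cases hlast : t = 2 * lowestUnset C + 2
  · have hnext : Late C (t + 1) := by omega
    have htop : (C + 1).testBit n := testBit_add_one_iff.2 (.inr ⟨by omega, h.testBit_top⟩)
    have hset : IsSet C t (lowestUnset C) := .inr ⟨rfl, hlast.ge⟩
    have hval := nextSet_add_one_of_le htop (Nat.zero_le _)
    have hadd := add_one_eq_clearBelow_lowestUnset_add_one C
    refine .inr (isBestSwitch_of_forall_ne trivial ?_ fun b hb hne ↦ ?_)
    · simp only [phasePolicy, via, dist, len, hubValue, if_neg hlate, if_pos hnext, hval,
        if_pos hset, toLex_add_toLex, Prod.Lex.toLex_lt_toLex]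
      omega
    · obtain ⟨k, rfl⟩ := eq_bit_of_edge_hub hb
      refine noGain_hub_bit h fun heq ↦ (hne ?_).elim
      simp only [phasePolicy, hubValue, if_pos hnext, bit.injEq, Fin.ext_iff, hval, heq]
  · refine .inl ⟨fun b hb ↦ ?_, ?_⟩
    · obtain ⟨k, rfl⟩ := eq_bit_of_edge_hub hb
      exact noGain_hub_bit h fun _ ↦ hlast
    · simp only [phasePolicy, hubValue, if_neg hlate, if_neg (show ¬ Late C (t + 1) by omega)]

theorem stepsTo_hub_increment (h : IsPhase n C t) (hlate : Late C t) :
    StepsTo C t (C + 1) 0 (hub : CounterNode n r) := by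
  refine .inl ⟨fun b hb ↦ ?_, ?_⟩
  · obtain ⟨k, rfl⟩ := eq_bit_of_edge_hub hb
    exact noGain_hub_bit h fun _ ↦ by omega
  · simp only [phasePolicy, hubValue, if_pos hlate, if_neg (show ¬ Late (C + 1) 0 by omega)]

theorem le_dist_high (C t : ℕ) {j k : ℕ} (hkj : k ≤ j) (hkn : j < n + 1)
    (hlate : Late C t → j ≠ lowestUnset C) :
    toLex (-(clearBelow C k : ℤ), 0) ≤ dist C t (high ⟨j, hkn⟩ : CounterNode n r) := by
  have := clearBelow_antitone C (hkj.trans j.le_succ)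
  rw [Nat.succ_eq_add_one] at this
  simp only [dist]
  split_ifs with hentry
  · have := clearBelow_add_two_pow_le (hentry.resolve_right fun h ↦ hlate h.2 h.1) hkj
    rw [Prod.Lex.toLex_le_toLex]
    omega
  · rw [Prod.Lex.toLex_le_toLex]
    omega

theorem eq_high_of_edge_lane_zero {s' : CounterNode n r} {hl : 0 < 2 * n + 1}
    (h : Edge (lane ⟨0, hl⟩) s') : ∃ k, s' = high k := by
  rcases s' with _ | l | m | m | j <;> simp [Edge] at h ⊢

theorem eq_hub_or_eq_lane_of_edge_lane_succ {l : ℕ} {s' : CounterNode n r}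
    {hl : l + 1 < 2 * n + 1} (h : Edge (lane ⟨l + 1, hl⟩) s') :
    s' = hub ∨ s' = lane ⟨l, by omega⟩ := by
  rcases s' with _ | l' | m | m | j
  · exact .inl rfl
  · exact .inr (congrArg lane (Fin.ext (Nat.succ_injective h).symm))
  · exact absurd h l.succ_ne_zero
  · exact h.elim
  · exact h.elim

theorem via_lane_hub (l : Fin (2 * n + 1)) :
    via (n := n) (r := r) C t (lane l) hub = toLex (-(hubValue C t : ℤ), 6 * (n : ℤ) + 1) := by
  simp only [via, dist, len, toLex_add_toLex, zero_add, add_zero]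

theorem via_lane_lane (l l' : Fin (2 * n + 1)) :
    via (n := n) (r := r) C t (lane l) (lane l') =
      if (l' : ℕ) ≤ t then toLex (-(C : ℤ), (l' : ℤ) + 1)
      else toLex (-(hubValue C t : ℤ), 6 * (n : ℤ) + 2) := by
  simp only [via, dist, len]
  split_ifs <;> simp only [toLex_add_toLex, zero_add, toLex_inj, Prod.mk.injEq, true_and] <;> ring

theorem via_lane_high (l : Fin (2 * n + 1)) (k : Fin (n + 1)) :
    via (n := n) (r := r) C t (lane l) (high k) = dist (n := n) (r := r) C t (high k) :=
  zero_add _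

theorem dist_lane_zero : dist C t (lane 0 : CounterNode n r) = toLex (-(C : ℤ), 0) := by
  simp [dist]

theorem noGain_lane_zero_high {k : Fin (n + 1)} (hlate : Late C t → (k : ℕ) ≠ lowestUnset C) :
    NoGain C t (lane 0 : CounterNode n r) (high k) := by
  rw [NoGain, via_lane_high, dist_lane_zero]
  simpa only [clearBelow_zero] using le_dist_high (r := r) C t k.1.zero_le k.2 hlate

theorem stepsTo_lane_zero_advance (hlate : ¬ Late C t) :
    StepsTo C t C (t + 1) (lane 0 : CounterNode n r) := by
  refine .inl ⟨fun b hb ↦ ?_, rfl⟩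
  obtain ⟨k, rfl⟩ := eq_high_of_edge_lane_zero hb
  exact noGain_lane_zero_high (absurd · hlate)

theorem stepsTo_lane_advance (hlate : ¬ Late C t) (l : Fin (2 * n + 1)) :
    StepsTo C t C (t + 1) (lane l : CounterNode n r) := by
  rcases l with ⟨_ | l, hl⟩
  · exact stepsTo_lane_zero_advance hlate
  have hhub : NoGain C t (lane ⟨l + 1, hl⟩ : CounterNode n r) hub := by
    rw [NoGain, via_lane_hub]
    simp only [dist, hubValue, if_neg hlate]
    split_ifs <;> rw [Prod.Lex.toLex_le_toLex] <;> omega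
  by_cases hlt : l = t
  · have hpol : phasePolicy C (t + 1) (lane ⟨l + 1, hl⟩ : CounterNode n r) =
        lane ⟨l, by omega⟩ := if_pos (by omega)
    rw [StepsTo, hpol]
    refine .inr (isBestSwitch_of_forall_ne rfl ?_ fun b hb hne ↦ ?_)
    · rw [via_lane_lane, if_pos hlt.le]
      simp only [dist, hubValue, if_neg hlate]
      rw [if_neg (by omega), Prod.Lex.toLex_lt_toLex]
      omega
    · rw [(eq_hub_or_eq_lane_of_edge_lane_succ hb).resolve_right hne]
      exact hhub
  · refine .inl ⟨fun b hb ↦ ?_, ?_⟩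
    · rcases eq_hub_or_eq_lane_of_edge_lane_succ hb with rfl | rfl
      · exact hhub
      · rw [NoGain, via_lane_lane]
        simp only [dist, hubValue, if_neg hlate]
        split_ifs <;> rw [Prod.Lex.toLex_le_toLex] <;> omega
    · have : l + 1 ≤ t + 1 ↔ l + 1 ≤ t := by omega
      simp only [phasePolicy, this]

theorem stepsTo_lane_zero_increment (h : IsPhase n C t) (hlate : Late C t) :
    StepsTo C t (C + 1) 0 (lane 0 : CounterNode n r) := by
  have htop : (C + 1).testBit n :=
    testBit_add_one_iff.2 (.inr ⟨h.lowestUnset_lt hlate, h.testBit_top⟩)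
  have hval := nextSet_add_one_of_le htop (Nat.zero_le _)
  have hentry : IsEntry C t (lowestUnset C) := .inr ⟨rfl, hlate⟩
  have hadd := add_one_eq_clearBelow_lowestUnset_add_one C
  have hpol : phasePolicy (C + 1) 0 (lane 0 : CounterNode n r) = high (nextSet (C + 1) 0) := rfl
  rw [StepsTo, hpol]
  refine .inr (isBestSwitch_of_forall_ne rfl ?_ fun b hb hne ↦ ?_)
  · rw [via_lane_high, dist_lane_zero]
    simp only [dist, hval, if_pos hentry]
    rw [Prod.Lex.toLex_lt_toLex]
    omega
  · obtain ⟨k, rfl⟩ := eq_high_of_edge_lane_zero hb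
    refine noGain_lane_zero_high fun _ heq ↦ hne (congrArg high (Fin.ext ?_))
    rw [hval, heq]

theorem stepsTo_lane_increment (h : IsPhase n C t) (hlate : Late C t) (l : Fin (2 * n + 1)) :
    StepsTo C t (C + 1) 0 (lane l : CounterNode n r) := by
  rcases l with ⟨_ | l, hl⟩
  · exact stepsTo_lane_zero_increment h hlate
  have hpol : phasePolicy (C + 1) 0 (lane ⟨l + 1, hl⟩ : CounterNode n r) = hub := by
    rw [phasePolicy, if_neg (Nat.not_succ_le_zero l)]
  have hlane : NoGain C t (lane ⟨l + 1, hl⟩ : CounterNode n r) (lane ⟨l, by omega⟩) := by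
    rw [NoGain, via_lane_lane]
    simp only [dist, hubValue, if_pos hlate]
    split_ifs <;> rw [Prod.Lex.toLex_le_toLex] <;> omega
  by_cases hlt : l + 1 ≤ t
  · rw [StepsTo, hpol]
    refine .inr (isBestSwitch_of_forall_ne l.succ_ne_zero ?_ fun b hb hne ↦ ?_)
    · rw [via_lane_hub]
      simp only [dist, hubValue, if_pos hlate, if_pos hlt]
      rw [Prod.Lex.toLex_lt_toLex]
      omega
    · rw [(eq_hub_or_eq_lane_of_edge_lane_succ hb).resolve_left hne]
      exact hlane
  · refine .inl ⟨fun b hb ↦ ?_, (if_neg hlt).trans hpol.symm⟩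
    rcases eq_hub_or_eq_lane_of_edge_lane_succ hb with rfl | rfl
    · rw [NoGain, via_lane_hub]
      simp only [dist, if_neg hlt, le_refl]
    · exact hlane

theorem eq_bit_or_exists_eq_high_of_edge_high {k : Fin (n + 1)} {s' : CounterNode n r}
    (h : Edge (high k) s') : s' = bit k ∨ ∃ m, k < m ∧ s' = high m := by
  rcases s' with _ | l | m | m | j
  · exact h.elim
  · exact h.elim
  · exact .inr ⟨m, h, rfl⟩
  · exact .inl (congrArg bit h)
  · exact h.elim

theorem noGain_high_bit (h : IsPhase n C t) {k : Fin (n + 1)}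
    (hk : (k : ℕ) = lowestUnset C → t ≠ 2 * lowestUnset C + 2) :
    NoGain C t (high k : CounterNode n r) (bit k) := by
  have := h.clock_le
  have := h.clock_le_lowestUnset
  by_cases hset : IsSet C t k
  · have hentry : IsEntry C t k := hset.imp_right fun hset ↦ ⟨hset.1, by have := hk hset.1; omega⟩
    simp only [NoGain, via, dist, len, if_pos hset, if_pos hentry, toLex_add_toLex, zero_add,
      le_refl]
  · have hentry : ¬ IsEntry C t k := mt (Or.imp_right fun hentry ↦ ⟨hentry.1, by omega⟩) hset
    have hlt := lt_clearBelow_add C k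
    rw [clearBelow_of_not_testBit (not_or.1 hset).1] at hlt
    simp only [NoGain, via, dist, len, if_neg hset, if_neg hentry, toLex_add_toLex,
      Prod.Lex.toLex_le_toLex]
    omega

theorem noGain_high_high {k m : Fin (n + 1)} (hkm : k < m)
    (hlate : Late C t → (m : ℕ) ≠ lowestUnset C) :
    NoGain C t (high k : CounterNode n r) (high m) := by
  have hpos : 0 < 2 ^ (k : ℕ) := by positivity
  calc dist C t (high k : CounterNode n r)
    _ ≤ toLex (0, 1) + toLex (-(clearBelow C (k + 1) : ℤ), 0) := by
      simp only [dist]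
      split_ifs <;> simp only [toLex_add_toLex, Prod.Lex.toLex_le_toLex] <;> omega
    _ ≤ via C t (high k) (high m) := add_le_add_right (le_dist_high C t hkm m.2 hlate) _

theorem stepsTo_high_advance (h : IsPhase n C t) (hlate : ¬ Late C t) (k : Fin (n + 1)) :
    StepsTo C t C (t + 1) (high k : CounterNode n r) := by
  by_cases hk : (k : ℕ) = lowestUnset C ∧ t = 2 * lowestUnset C + 2
  · have hentry : ¬ IsEntry C t k := by
      rintro (hbit | hentry)
      · exact not_testBit_lowestUnset C (hk.1 ▸ hbit)
      · exact hlate hentry.2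
    have hset : IsSet C t k := .inr ⟨hk.1, hk.2.ge⟩
    have hpol : phasePolicy C (t + 1) (high k : CounterNode n r) = bit k :=
      if_pos (.inr ⟨hk.1, congrArg Nat.succ hk.2⟩)
    rw [StepsTo, hpol]
    refine .inr (isBestSwitch_of_forall_ne rfl ?_ fun b hb hne ↦ ?_)
    · have hpos : 0 < 2 ^ (k : ℕ) := by positivity
      simp only [via, dist, len, if_pos hset, if_neg hentry, toLex_add_toLex,
        Prod.Lex.toLex_lt_toLex]
      omega
    · obtain ⟨m, hkm, rfl⟩ := (eq_bit_or_exists_eq_high_of_edge_high hb).resolve_left hne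
      exact noGain_high_high hkm (absurd · hlate)
  · refine .inl ⟨fun b hb ↦ ?_, ?_⟩
    · rcases eq_bit_or_exists_eq_high_of_edge_high hb with rfl | ⟨m, hkm, rfl⟩
      · exact noGain_high_bit h fun hki ht ↦ hk ⟨hki, ht⟩
      · exact noGain_high_high hkm (absurd · hlate)
    · have : IsEntry C (t + 1) k ↔ IsEntry C t k := or_congr_right (by omega)
      simp only [phasePolicy, this]

theorem stepsTo_high_increment_of_lt (h : IsPhase n C t) (hlate : Late C t) {k : Fin (n + 1)}
    (hk : (k : ℕ) < lowestUnset C) : StepsTo C t (C + 1) 0 (high k : CounterNode n r) := by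
  have hi := h.lowestUnset_lt hlate
  have htop : (C + 1).testBit n := testBit_add_one_iff.2 (.inr ⟨hi, h.testBit_top⟩)
  have hval := nextSet_add_one_of_le htop (Nat.succ_le_of_lt hk)
  have hentry : ¬ IsEntry (C + 1) 0 k := by
    rw [IsEntry, testBit_add_one_iff]
    omega
  have hpol : phasePolicy (C + 1) 0 (high k : CounterNode n r) =
    high (nextSet (C + 1) (k + 1)) := if_neg hentry
  rw [StepsTo, hpol]
  refine .inr (isBestSwitch_of_forall_ne (Fin.lt_def.2 (hval ▸ hk)) ?_ fun b hb hne ↦ ?_)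
  · have hadd := add_one_eq_clearBelow_lowestUnset_add_one C
    have hle := clearBelow_add_two_pow_le (testBit_of_lt_lowestUnset hk) (Nat.zero_le _)
    rw [clearBelow_zero] at hle
    have hentry_low : IsEntry C t (lowestUnset C) := .inr ⟨rfl, hlate⟩
    have hentry_k : IsEntry C t k := .inl (testBit_of_lt_lowestUnset hk)
    simp only [via, dist, len, hval, if_pos hentry_low, if_pos hentry_k, toLex_add_toLex,
      Prod.Lex.toLex_lt_toLex]
    omega
  · rcases eq_bit_or_exists_eq_high_of_edge_high hb with rfl | ⟨m, hkm, rfl⟩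
    · exact noGain_high_bit h (absurd · hk.ne)
    · exact noGain_high_high hkm fun _ heq ↦ hne (congrArg high (Fin.ext (heq.trans hval.symm)))

theorem stepsTo_high_increment (h : IsPhase n C t) (hlate : Late C t) (k : Fin (n + 1)) :
    StepsTo C t (C + 1) 0 (high k : CounterNode n r) := by
  rcases lt_or_ge (k : ℕ) (lowestUnset C) with hk | hk
  · exact stepsTo_high_increment_of_lt h hlate hk
  refine .inl ⟨fun b hb ↦ ?_, ?_⟩
  · rcases eq_bit_or_exists_eq_high_of_edge_high hb with rfl | ⟨m, hkm, rfl⟩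
    · exact noGain_high_bit h fun _ ↦ by omega
    · exact noGain_high_high hkm fun _ ↦ by omega
  · have hentry : IsEntry (C + 1) 0 k ↔ IsEntry C t k := by
      have hzero : ¬ Late (C + 1) 0 := by omega
      have := hk.eq_or_lt'
      rw [IsEntry, IsEntry, testBit_add_one_iff]
      tauto
    simp only [phasePolicy, hentry, nextSet_add_one_of_lt (Nat.lt_succ_of_le hk)]

theorem eq_or_exists_eq_of_edge_bit {k : Fin (n + 1)} {s' : CounterNode n r}
    (h : Edge (bit k) s') :
    s' = hub ∨ (∃ l : Fin (2 * n + 1), (l : ℕ) ≤ 2 * k ∧ s' = lane l) ∨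
      ∃ m, k < m ∧ s' = high m := by
  rcases s' with _ | l | m | m | j
  · exact .inl rfl
  · exact .inr (.inl ⟨l, h.2, rfl⟩)
  · exact .inr (.inr ⟨m, h, rfl⟩)
  · exact h.elim
  · exact h.elim

theorem hubValue_lt {k : ℕ} (hlate : Late C t → lowestUnset C ≤ k) :
    hubValue C t < clearBelow C (k + 1) + 2 ^ (k + 1) := by
  unfold hubValue
  split_ifs with h
  · rw [← clearBelow_add_one_of_lowestUnset_lt (Nat.lt_succ_of_le (hlate h))]
    exact lt_clearBelow_add _ _
  · exact lt_clearBelow_add _ _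

theorem via_bit_hub (k : Fin (n + 1)) :
    via (n := n) (r := r) C t (bit k) hub =
      toLex ((2 ^ (k : ℕ) : ℕ) - 1 - (hubValue C t : ℤ), 6 * (n : ℤ) + 2) := by
  simp only [via, dist, len, toLex_add_toLex, add_zero, sub_eq_add_neg]

theorem via_bit_lane (k : Fin (n + 1)) (l : Fin (2 * n + 1)) :
    via (n := n) (r := r) C t (bit k) (lane l) =
      if (l : ℕ) ≤ t then toLex ((2 ^ (k : ℕ) : ℕ) - 1 - (C : ℤ), 6 * (n : ℤ) + 1 - l)
      else toLex ((2 ^ (k : ℕ) : ℕ) - 1 - (hubValue C t : ℤ), 12 * (n : ℤ) + 2 - 2 * l) := by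
  simp only [via, dist, len]
  split_ifs <;> simp only [toLex_add_toLex, toLex_inj, Prod.mk.injEq] <;> constructor <;> ring

theorem le_via_bit_high {k m : Fin (n + 1)} (hkm : k < m)
    (hlate : Late C t → (m : ℕ) ≠ lowestUnset C) :
    toLex (-((2 ^ (k : ℕ) + clearBelow C (k + 1) : ℕ) : ℤ), (0 : ℤ)) ≤
      via (n := n) (r := r) C t (bit k) (high m) := by
  calc toLex (-((2 ^ (k : ℕ) + clearBelow C (k + 1) : ℕ) : ℤ), (0 : ℤ))
    _ = toLex (-((2 ^ (k : ℕ) : ℕ) : ℤ), (0 : ℤ)) + toLex (-(clearBelow C (k + 1) : ℤ), 0) := by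
      rw [toLex_add_toLex, Nat.cast_add, neg_add, add_zero]
    _ ≤ via C t (bit k) (high m) := add_le_add_right (le_dist_high C t hkm m.2 hlate) _

theorem isSettled_bit {k : Fin (n + 1)} (hset : IsSet C t k)
    (hlate : Late C t → lowestUnset C ≤ k) : IsSettled C t (bit k : CounterNode n r) := by
  have hle := le_hubValue C t
  have hlt := hubValue_lt hlate
  rw [pow_succ] at hlt
  intro b hb
  rcases eq_or_exists_eq_of_edge_bit hb with rfl | ⟨l, -, rfl⟩ | ⟨m, hkm, rfl⟩
  · rw [NoGain, via_bit_hub]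
    simp only [dist, if_pos hset, Prod.Lex.toLex_le_toLex]
    omega
  · rw [NoGain, via_bit_lane]
    simp only [dist, if_pos hset]
    split_ifs <;> rw [Prod.Lex.toLex_le_toLex] <;> omega
  · have := le_via_bit_high (r := r) hkm fun hl ↦ by have := hlate hl; omega
    simpa only [NoGain, dist, if_pos hset, add_comm] using this

theorem phasePolicy_bit_of_isSet {k : Fin (n + 1)} (hset : IsSet C t k) :
    phasePolicy C t (bit k : CounterNode n r) = high (nextSet C (k + 1)) := if_pos hset

theorem phasePolicy_bit_zero {k : Fin (n + 1)} (hbit : ¬ C.testBit k) :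
    phasePolicy C 0 (bit k : CounterNode n r) = hub := by
  rw [phasePolicy, if_neg (by rw [not_or]; exact ⟨hbit, by omega⟩), if_pos rfl]

theorem isBestSwitch_bit_lane {k : Fin (n + 1)} (hlate : ¬ Late C t)
    (hset : ¬ IsSet C t k) (hkn : (k : ℕ) < n) (ht : t ≤ 2 * k) :
    IsBestSwitch C t (bit k : CounterNode n r) (lane ⟨t, by omega⟩) := by
  refine ⟨⟨hkn, ht⟩, ?_, fun b hb hne ↦ ?_⟩
  · rw [via_bit_lane, if_pos le_rfl]
    simp only [dist, if_neg hset, Prod.Lex.toLex_lt_toLex]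
    exact .inr ⟨trivial, by omega⟩
  rcases eq_or_exists_eq_of_edge_bit hb with rfl | ⟨l, -, rfl⟩ | ⟨m, -, rfl⟩
  · left
    rw [NoGain, via_bit_hub]
    simp only [dist, if_neg hset, hubValue, if_neg hlate, Prod.Lex.toLex_le_toLex]
    exact .inr ⟨trivial, by omega⟩
  · left
    have hlt : (l : ℕ) ≠ t := fun heq ↦ hne (congrArg lane (Fin.ext heq))
    rw [NoGain, via_bit_lane]
    simp only [dist, if_neg hset, hubValue, if_neg hlate]
    split_ifs <;> exact Prod.Lex.toLex_le_toLex.2 (.inr ⟨rfl, by dsimp only; omega⟩)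
  · exact .inr (.inr ⟨id, trivial⟩)

theorem via_bit_high_nextSet_lt (h : IsPhase n C t) (hlate : ¬ Late C t) {k m : Fin (n + 1)}
    (hkm : k < m) (hm : m ≠ nextSet C (k + 1)) :
    via (n := n) (r := r) C t (bit k) (high (nextSet C (k + 1))) <
      via (n := n) (r := r) C t (bit k) (high m) := by
  refine add_lt_add_right ?_ _
  rw [dist_high_nextSet h (k := k + 1) (hkm.trans_le (Fin.le_last m))]
  have hanti : clearBelow C (m + 1) ≤ clearBelow C (k + 1) :=
    clearBelow_antitone C (Nat.succ_le_succ hkm.le)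
  by_cases hbit : C.testBit m
  · have hlt : clearBelow C m < clearBelow C (k + 1) :=
      clearBelow_lt_of_ne_nextSet h.testBit_top hkm hbit hm
    rw [clearBelow_of_testBit hbit] at hlt
    simp only [dist, if_pos (show IsEntry C t m from .inl hbit), Prod.Lex.toLex_lt_toLex]
    omega
  · simp only [dist, if_neg (show ¬ IsEntry C t m from (·.elim hbit (hlate ·.2))),
      Prod.Lex.toLex_lt_toLex]
    omega

theorem isBestSwitch_bit_high (h : IsPhase n C t) {k : Fin (n + 1)}
    (hk : (k : ℕ) = lowestUnset C) (hkn : (k : ℕ) < n) (ht : t = 2 * k + 1) :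
    IsBestSwitch C t (bit k : CounterNode n r) (high (nextSet C (k + 1))) := by
  have hbit : ¬ C.testBit k := hk ▸ not_testBit_lowestUnset C
  have hset : ¬ IsSet C t k := (·.elim hbit fun hset ↦ by omega)
  have hlate : ¬ Late C t := by omega
  have hadd : C + 1 = clearBelow C (k + 1) + 2 ^ (k : ℕ) :=
    hk ▸ add_one_eq_clearBelow_lowestUnset_add_one C
  have hpos : 0 < 2 ^ (k : ℕ) := by positivity
  refine ⟨(nextSet_mem h.testBit_top (Nat.succ_le_of_lt hkn)).1, ?_, fun b hb hne ↦ ?_⟩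
  · rw [via, dist_high_nextSet h (k := k + 1) hkn]
    simp only [len, dist, if_neg hset, toLex_add_toLex, Prod.Lex.toLex_lt_toLex]
    omega
  rcases eq_or_exists_eq_of_edge_bit hb with rfl | ⟨l, hl, rfl⟩ | ⟨m, hkm, rfl⟩
  · left
    rw [NoGain, via_bit_hub]
    simp only [dist, if_neg hset, hubValue, if_neg hlate, Prod.Lex.toLex_le_toLex]
    exact .inr ⟨trivial, by omega⟩
  · left
    rw [NoGain, via_bit_lane, if_pos (by omega)]
    simp only [dist, if_neg hset, Prod.Lex.toLex_le_toLex]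
    exact .inr ⟨trivial, by omega⟩
  · exact .inr (.inl ⟨Iff.rfl, via_bit_high_nextSet_lt h hlate hkm fun heq ↦ hne (heq ▸ rfl)⟩)

theorem stepsTo_bit_advance (h : IsPhase n C t) (hlate : ¬ Late C t) {k : Fin (n + 1)}
    (hkn : (k : ℕ) < n) : StepsTo C t C (t + 1) (bit k : CounterNode n r) := by
  by_cases hset : IsSet C t k
  · have hset' : IsSet C (t + 1) k := hset.imp_right fun hset ↦ ⟨hset.1, by omega⟩
    refine .inl ⟨isSettled_bit hset (absurd · hlate), ?_⟩
    rw [phasePolicy_bit_of_isSet hset, phasePolicy_bit_of_isSet hset']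
  have hle := lowestUnset_le (not_or.1 hset).1
  have hclock := h.clock_le_lowestUnset
  rcases le_or_gt t (2 * k) with ht | ht
  · have hset' : ¬ IsSet C (t + 1) k := mt (Or.imp_right fun hset ↦ ⟨hset.1, by omega⟩) hset
    have hpol : phasePolicy C (t + 1) (bit k : CounterNode n r) = lane ⟨t, by omega⟩ := by
      rw [phasePolicy, if_neg hset', if_neg t.succ_ne_zero]
      exact congrArg lane (Fin.ext (min_eq_left (by omega)))
    rw [StepsTo, hpol]
    exact .inr (isBestSwitch_bit_lane hlate hset hkn ht)
  · have hk : (k : ℕ) = lowestUnset C := by omega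
    have hset' : IsSet C (t + 1) k := .inr ⟨hk, by omega⟩
    have ht : t = 2 * k + 1 := by
      have := fun ht ↦ hset (.inr ⟨hk, ht⟩)
      omega
    rw [StepsTo, phasePolicy_bit_of_isSet hset']
    exact .inr (isBestSwitch_bit_high h hk hkn ht)

theorem via_bit_hub_lt (hlate : Late C t) {k : Fin (n + 1)}
    (hk : (k : ℕ) < lowestUnset C ∨ ¬ IsSet C t k) :
    via (n := n) (r := r) C t (bit k) hub < dist (n := n) (r := r) C t (bit k) := by
  rw [via_bit_hub]
  simp only [dist, hubValue, if_pos hlate]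
  split_ifs with hset <;> rw [Prod.Lex.toLex_lt_toLex]
  · have hlt := hk.resolve_right (not_not.2 hset)
    have hadd := add_one_eq_clearBelow_add hlt.le
    rw [clearBelow_of_testBit (testBit_of_lt_lowestUnset hlt)] at hadd
    omega
  · omega

theorem isBestSwitch_bit_hub (hlate : Late C t) {k : Fin (n + 1)}
    (hkn : (k : ℕ) < n) (hk : (k : ℕ) < lowestUnset C ∨ ¬ IsSet C t k) :
    IsBestSwitch C t (bit k : CounterNode n r) hub := by
  refine ⟨hkn, via_bit_hub_lt hlate hk, fun b hb hne ↦ ?_⟩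
  rcases eq_or_exists_eq_of_edge_bit hb with rfl | ⟨l, hl, rfl⟩ | ⟨m, -, rfl⟩
  · exact absurd rfl hne
  · right; left
    refine ⟨Iff.rfl, ?_⟩
    rw [via_bit_hub, via_bit_lane]
    simp only [hubValue, if_pos hlate]
    split_ifs <;> rw [Prod.Lex.toLex_lt_toLex]
    · omega
    · exact .inr ⟨rfl, by dsimp only; omega⟩
  · exact .inr (.inr ⟨id, trivial⟩)

theorem stepsTo_bit_increment (hlate : Late C t) {k : Fin (n + 1)}
    (hkn : (k : ℕ) < n) : StepsTo C t (C + 1) 0 (bit k : CounterNode n r) := by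
  by_cases hk : (k : ℕ) < lowestUnset C ∨ ¬ IsSet C t k
  · have hbit : ¬ (C + 1).testBit k := by
      rw [testBit_add_one_iff]
      rintro (heq | ⟨hlt, hbit⟩)
      · exact hk.elim heq.not_lt fun hset ↦ hset (.inr ⟨heq, by omega⟩)
      · exact hk.elim hlt.not_gt fun hset ↦ hset (.inl hbit)
    rw [StepsTo, phasePolicy_bit_zero hbit]
    exact .inr (isBestSwitch_bit_hub hlate hkn hk)
  · rw [not_or, not_not, not_lt] at hk
    have hset' : IsSet (C + 1) 0 k := by
      refine .inl (testBit_add_one_iff.2 ?_)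
      rcases hk.1.eq_or_lt with heq | hlt
      · exact .inl heq.symm
      · exact .inr ⟨hlt, hk.2.resolve_right fun hset ↦ hlt.ne' hset.1⟩
    refine .inl ⟨isSettled_bit hk.2 fun _ ↦ hk.1, ?_⟩
    rw [phasePolicy_bit_of_isSet hk.2, phasePolicy_bit_of_isSet hset',
      nextSet_add_one_of_lt (Nat.lt_succ_of_le hk.1)]

theorem stepsTo_advance (h : IsPhase n C t) (hlate : ¬ Late C t) (ht : t ≤ 2 * n)
    {s s' : CounterNode n r} (hs : Edge s s') : StepsTo C t C (t + 1) s := by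
  rcases s with _ | l | k | k | j
  · exact stepsTo_hub_advance h hlate ht
  · exact stepsTo_lane_advance hlate l
  · exact stepsTo_high_advance h hlate k
  · exact stepsTo_bit_advance h hlate (lt_of_edge_bit hs)
  · exact hs.elim

theorem stepsTo_increment (h : IsPhase n C t) (hlate : Late C t) {s s' : CounterNode n r}
    (hs : Edge s s') : StepsTo C t (C + 1) 0 s := by
  rcases s with _ | l | k | k | j
  · exact stepsTo_hub_increment h hlate
  · exact stepsTo_lane_increment h hlate l
  · exact stepsTo_high_increment h hlate k
  · exact stepsTo_bit_increment hlate (lt_of_edge_bit hs)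
  · exact hs.elim

theorem StepsTo.isSettled {C' t' : ℕ} {s s' : CounterNode n r} (hsteps : StepsTo C t C' t' s)
    (h : IsPhase n C t) (hs : Edge s s') (heq : phasePolicy C t s = phasePolicy C' t' s) :
    IsSettled C t s :=
  hsteps.elim And.left fun hbest ↦
    absurd hbest.lt (heq ▸ (dist_eq_via_phasePolicy h hs).not_gt)

theorem IsPhase.advance (h : IsPhase n C t) (hlate : ¬ Late C t) (ht : t ≤ 2 * n) :
    IsPhase n C (t + 1) where
  two_pow_le := h.two_pow_le
  lt_two_pow := h.lt_two_pow
  clock_le_lowestUnset := by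
    have := h.clock_le_lowestUnset
    omega
  clock_le := Nat.succ_le_succ ht

theorem isPhase_zero (hle : 2 ^ n ≤ C) (hlt : C < 2 ^ (n + 1)) : IsPhase n C 0 :=
  ⟨hle, hlt, Nat.zero_le _, Nat.zero_le _⟩

theorem IsPhase.increment (h : IsPhase n C t) (hlate : Late C t) : IsPhase n (C + 1) 0 :=
  isPhase_zero (h.two_pow_le.trans C.le_succ)
    (add_one_lt_two_pow_of_lowestUnset_lt h.lt_two_pow
      ((h.lowestUnset_lt hlate).trans n.lt_succ_self))

theorem phasePolicy_eq_of_not_late (h : IsPhase n C (2 * n + 1)) (hlate : ¬ Late C (2 * n + 1))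
    {s s' : CounterNode n r} (hs : Edge s s') :
    phasePolicy C (2 * n) s = phasePolicy C (2 * n + 1) s := by
  have hclock := h.clock_le_lowestUnset
  have hlate' : ¬ Late C (2 * n) := by omega
  rcases s with _ | ⟨_ | l, hl⟩ | k | k | j
  · simp only [phasePolicy, hubValue, if_neg hlate, if_neg hlate']
  · rfl
  · simp only [phasePolicy]
    rw [if_pos (by omega), if_pos (by omega)]
  · simp only [phasePolicy, IsEntry, hlate, hlate', and_false]
  · have hbit : C.testBit k := testBit_of_lt_lowestUnset (by have := lt_of_edge_bit hs; omega)
    rw [phasePolicy_bit_of_isSet (.inl hbit), phasePolicy_bit_of_isSet (.inl hbit)]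
  · exact hs.elim

theorem Follows.isOptimal (hπ : Follows π C (2 * n + 1)) (h : IsPhase n C (2 * n + 1))
    (hlate : ¬ Late C (2 * n + 1)) : (counterGraph n r).toMDP.IsOptimal π := by
  have hclock := h.clock_le_lowestUnset
  have h' : IsPhase n C (2 * n) := ⟨h.two_pow_le, h.lt_two_pow, by omega, by omega⟩
  have hπ' : Follows π C (2 * n) := fun s s' hs ↦
    (hπ s s' hs).trans (phasePolicy_eq_of_not_late h hlate hs).symm
  refine ReachabilityMDP.isOptimal_of_forall_not_switchable _ (hπ'.isDist h').isPolicy fun s ↦ ?_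
  have hsettled : IsSettled C (2 * n) s := fun s' hs ↦
    (stepsTo_advance h' (by omega) le_rfl hs).isSettled h' hs
      (phasePolicy_eq_of_not_late h hlate hs) s' hs
  exact hsettled.not_switchable hπ' h'

theorem Follows.not_isOptimal (hπ : Follows π C t) (h : IsPhase n C t)
    (hC : C + 1 < 2 ^ (n + 1)) : ¬ (counterGraph n r).toMDP.IsOptimal π := by
  have h' : IsPhase n (C + 1) 0 := isPhase_zero (h.two_pow_le.trans C.le_succ) hC
  have hdist := Follows.isDist (r := r) (π := phasePolicy (C + 1) 0) (fun _ _ _ ↦ rfl) h'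
  have hedge : Edge (lane 0 : CounterNode n r) (high 0) := rfl
  refine (hπ.isDist h).not_isOptimal_of_lt hdist (edges_counterGraph_nonempty.2 ⟨_, hedge⟩) ?_
  simp only [codedDist, dist_lane_zero, potential, toLex_sub_toLex, code_toLex]
  rw [Nat.cast_succ]
  linarith

theorem Follows.isOptimal_or_exists_isPhase (hπ : Follows π C t) (h : IsPhase n C t)
    (hstep : (counterGraph n r).toMDP.GreedyStep π π') :
    (counterGraph n r).toMDP.IsOptimal π ∨
      ∃ C' t', IsPhase n C' t' ∧ Follows π' C' t' ∧ C' ≤ C + 1 ∧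
        (2 * n + 2) * C + t < (2 * n + 2) * C' + t' := by
  by_cases hlate : Late C t
  · refine .inr ⟨C + 1, 0, h.increment hlate, ?_, le_rfl, ?_⟩
    · exact hπ.greedyStep h (fun s s' hs ↦ stepsTo_increment h hlate hs) hstep
    · have := h.clock_le
      rw [mul_add]
      omega
  rcases h.clock_le.lt_or_eq with ht | rfl
  · rw [Nat.lt_succ_iff] at ht
    refine .inr ⟨C, t + 1, h.advance hlate ht, ?_, C.le_succ, by omega⟩
    exact hπ.greedyStep h (fun s s' hs ↦ stepsTo_advance h hlate ht hs) hstep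
  · exact .inl (hπ.isOptimal h hlate)

section Run

variable {π : ℕ → CounterNode n r → CounterNode n r} {k : ℕ}

theorem exists_isPhase_of_run (hzero : π 0 = phasePolicy (2 ^ n) 0)
    (hstep : ∀ k, (counterGraph n r).toMDP.GreedyStep (π k) (π (k + 1)))
    (hk : ∀ j < k, ¬ (counterGraph n r).toMDP.IsOptimal (π j)) :
    ∃ C t, IsPhase n C t ∧ Follows (π k) C t ∧ C ≤ 2 ^ n + k ∧ k ≤ (2 * n + 2) * C + t := by
  induction k with
  | zero =>
    exact ⟨2 ^ n, 0, isPhase_zero le_rfl (Nat.pow_lt_pow_succ one_lt_two),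
      fun s _ _ ↦ congrFun hzero s, le_rfl, Nat.zero_le _⟩
  | succ k ih =>
    obtain ⟨C, t, h, hπ, hC, hprogress⟩ := ih fun j hj ↦ hk j (hj.trans k.lt_succ_self)
    obtain ⟨C', t', h', hπ', hC', hlt⟩ :=
      (hπ.isOptimal_or_exists_isPhase h (hstep k)).resolve_left (hk k k.lt_succ_self)
    exact ⟨C', t', h', hπ', by omega, by omega⟩

theorem exists_isOptimal_of_run (hzero : π 0 = phasePolicy (2 ^ n) 0)
    (hstep : ∀ k, (counterGraph n r).toMDP.GreedyStep (π k) (π (k + 1))) :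
    ∃ k, (counterGraph n r).toMDP.IsOptimal (π k) := by
  by_contra! hnot
  obtain ⟨C, t, h, -, -, hle⟩ := exists_isPhase_of_run (k := (2 * n + 2) * 2 ^ (n + 1)) hzero hstep
    fun j _ ↦ hnot j
  have hmul : (2 * n + 2) * (C + 1) ≤ (2 * n + 2) * 2 ^ (n + 1) :=
    Nat.mul_le_mul_left _ h.lt_two_pow
  have := h.clock_le
  rw [mul_add] at hmul
  omega

theorem two_pow_le_of_isOptimal (hzero : π 0 = phasePolicy (2 ^ n) 0)
    (hstep : ∀ k, (counterGraph n r).toMDP.GreedyStep (π k) (π (k + 1)))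
    (hopt : (counterGraph n r).toMDP.IsOptimal (π k))
    (hk : ∀ j < k, ¬ (counterGraph n r).toMDP.IsOptimal (π j)) : 2 ^ n ≤ k + 1 := by
  obtain ⟨C, t, h, hπ, hC, -⟩ := exists_isPhase_of_run hzero hstep hk
  by_contra! hlt
  refine hπ.not_isOptimal h ?_ hopt
  rw [pow_succ]
  omega

end Run

theorem isPolicy_phasePolicy (h : IsPhase n C t) :
    (counterGraph n r).toMDP.IsPolicy (phasePolicy C t) :=
  (Follows.isDist (fun _ _ _ ↦ rfl) h).isPolicy

end CounterNode

theorem two_rpow_le_of_two_pow_le {N n T : ℕ} (hN : N ≤ 16 * (n - 1)) (hn : 2 ≤ n)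
    (hT : 2 ^ n ≤ T + 1) : (2 : ℝ) ^ (1 / 16 * (N : ℝ)) ≤ T := by
  have hexp : 1 / 16 * (N : ℝ) ≤ (n - 1 : ℕ) := by
    have : (N : ℝ) ≤ 16 * (n - 1 : ℕ) := mod_cast hN
    linarith
  have hle : 2 ^ (n - 1) ≤ T := by
    obtain ⟨m, rfl⟩ : ∃ m, n = m + 1 := ⟨n - 1, by omega⟩
    have : 0 < 2 ^ m := by positivity
    rw [pow_succ] at hT
    rw [Nat.add_sub_cancel]
    omega
  calc (2 : ℝ) ^ (1 / 16 * (N : ℝ))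
    _ ≤ 2 ^ ((n - 1 : ℕ) : ℝ) := Real.rpow_le_rpow_of_exponent_le one_le_two hexp
    _ = ((2 ^ (n - 1) : ℕ) : ℝ) := by rw [Real.rpow_natCast, Nat.cast_pow, Nat.cast_ofNat]
    _ ≤ T := mod_cast hle

theorem mainTheorem3 :
    ∃ c : ℝ, 0 < c ∧ ∃ N₀ : ℕ, ∀ N : ℕ, N₀ ≤ N →
      ∃ (S A : Type) (_ : Fintype S) (_ : DecidableEq S) (M : ReachabilityMDP S A) (π₀ : S → A),
        Fintype.card S = N ∧
        (∀ s, (M.act s).card ≤ N) ∧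
        M.IsPolicy π₀ ∧
        ∀ π : ℕ → S → A, π 0 = π₀ → (∀ k, M.GreedyStep (π k) (π (k + 1))) →
          ∃ T : ℕ, (2 : ℝ) ^ (c * (N : ℝ)) ≤ (T : ℝ) ∧
            M.IsOptimal (π T) ∧ ∀ k < T, ¬ M.IsOptimal (π k) := by
  refine ⟨1 / 16, by norm_num, 16, fun N hN ↦ ?_⟩
  obtain ⟨n, r, hn, hNn, hcard⟩ : ∃ n r, 2 ≤ n ∧ N ≤ 16 * (n - 1) ∧ N = 4 * n + r + 5 :=
    ⟨(N - 5) / 4, (N - 5) % 4, by omega, by omega, by omega⟩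
  rw [← CounterNode.card_eq] at hcard
  refine ⟨CounterNode n r, CounterNode n r, inferInstance, inferInstance,
    (CounterNode.counterGraph n r).toMDP, CounterNode.phasePolicy (2 ^ n) 0, hcard.symm,
    fun s ↦ hcard ▸ Finset.card_le_univ _, ?_, fun π hzero hstep ↦ ?_⟩
  · exact CounterNode.isPolicy_phasePolicy
      (CounterNode.isPhase_zero le_rfl (Nat.pow_lt_pow_succ one_lt_two))
  classical
  have hex := CounterNode.exists_isOptimal_of_run hzero hstep
  have hmin : ∀ k < Nat.find hex, _ := fun k ↦ Nat.find_min hex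
  have hT := CounterNode.two_pow_le_of_isOptimal hzero hstep (Nat.find_spec hex) hmin
  exact ⟨Nat.find hex, two_rpow_le_of_two_pow_le hNn hn hT, Nat.find_spec hex, hmin⟩
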